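/- For $m\ge 0$, the linear classification model $LC_m$ on the universe $\mathcal X=\mathbb F_2^m\times\mathbb F_2$ is the following prior over distributions on $\mathcal X$: uniformly random coefficients $a,b_1,\dots,b_m\in\mathbb F_2$ are drawn, and the hypothesis $p$ is the uniform distribution on the graph $\{(y,\ell(y)):y\in\mathbb F_2^m\}$ of $\ell(y)=a+\sum_k b_ky_k$. In the Bayesian adaptive data analysis game, a hypothesis $p$ is drawn from the prior, unknown to both players, and the curator receives $n$ independent samples from $p$. In each of $q$ rounds the analyst asks a query $f:\mathcal X\to[0,1]$, which may depend on all earlier answers and on private randomness independent of $p$, of the samples and of the noise. The noisy posterior mean curator answers with $$\sum_j w_j'\,\mathbb E_{x\sim p_j}f(x)+Z,$$ where $p_j$ runs over the hypotheses, $w_j'$ is the posterior weight of $p_j$ given the $n$ samples (Bayes' rule), and $Z\sim N(0,\tfrac1{4n})$ is fresh independent noise in each round. An answer $a$ to $f$ is $\epsilon$-accurate if $|\mathbb E_{x\sim p}f(x)-a|<\epsilon$. **Theorem.** There is an absolute constant $C>0$ such that for all $m\ge 0$ (in particular for $m=n$), all $q\ge1$, all $0<\epsilon,\delta<1$ and all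 $$n\ \ge\ \frac{C}{\epsilon^2}\log\frac q\delta ,$$ the following holds under the model $LC_m$ with $n$ samples: against every adaptive analyst strategy, with probability at least $1-\delta$ (over the hypothesis, the samples, the noise and the analyst's randomness), the noisy posterior mean curator answers all $q$ queries $\epsilon$-accurately. -/

import Mathlib

open MeasureTheory ProbabilityTheory
open scoped ENNReal NNReal

noncomputable section

namespace AdaptiveData

/-- A finite model: a prior over hypotheses `j : J`, each of which is a distribution `hyp j` on
the universe `X`. -/
structure Model (J X : Type) where
  prior : PMF J
  hyp : J → PMF X

/-- The mean `E_{x ∼ p} f(x)` of a query under a distribution on a finite universe. -/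
def mean {X : Type} [Fintype X] (p : PMF X) (f : X → unitInterval) : ℝ :=
  ∑ x, (p x).toReal * (f x : ℝ)

namespace Model

variable {J X : Type}

/-- The prior weight of hypothesis `j` times the likelihood of the samples under it. -/
def jointWeight (M : Model J X) {n : ℕ} (x : Fin n → X) (j : J) : ℝ :=
  (M.prior j).toReal * ∏ i, (M.hyp j (x i)).toReal

/-- The posterior weight of hypothesis `j` after the samples `x`, by Bayes' rule. -/
def posteriorWeight [Fintype J] (M : Model J X) {n : ℕ} (x : Fin n → X) (j : J) : ℝ :=
  M.jointWeight x j / ∑ j', M.jointWeight x j'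

/-- The posterior mean of the query `f` after the samples `x`. -/
def posteriorMean [Fintype J] [Fintype X] (M : Model J X) {n : ℕ} (x : Fin n → X)
    (f : X → unitInterval) : ℝ :=
  ∑ j, M.posteriorWeight x j * mean (M.hyp j) f

end Model

/-- An adaptive, possibly randomized analyst. She has a private random seed `s : S`; her query
number `k` (counted from `0`) may depend on the seed and on the `k` answers received so far. -/
structure Analyst (X : Type) (S : Type*) [MeasurableSpace S] where
  query : (k : ℕ) → S → (Fin k → ℝ) → X → unitInterval
  measurable_query : ∀ (k : ℕ) (x : X),
    Measurable fun p : S × (Fin k → ℝ) => query k p.1 p.2 x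

section Game

variable {J X : Type} [Fintype J] [Fintype X] {S : Type*} [MeasurableSpace S]

/-- The answers to the first `q` queries of the noisy posterior mean curator who holds the samples
`x`, when the additive noises are `z 0, …, z (q - 1)` and the seed of the analyst is `s`. -/
def noisyAnswers (M : Model J X) (A : Analyst X S) (s : S) {n : ℕ} (x : Fin n → X) :
    {q : ℕ} → (Fin q → ℝ) → (Fin q → ℝ)
  | 0, _ => Fin.elim0
  | q + 1, z =>
    let past : Fin q → ℝ := noisyAnswers M A s x (Fin.init z)
    Fin.snoc past (M.posteriorMean x (A.query q s past) + z (Fin.last q))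

/-- The query that the analyst asks in round `k` when the answers are `a`: it depends only on
the answers to the earlier rounds. -/
def Analyst.asked (A : Analyst X S) (s : S) {q : ℕ} (a : Fin q → ℝ) (k : Fin q) :
    X → unitInterval :=
  A.query k s fun i : Fin k => a (Fin.castLE k.isLt.le i)

/-- The answers really follow the protocol: the answer in round `k` is the posterior mean of the
query asked in round `k`, plus the noise of that round. -/
theorem noisyAnswers_apply (M : Model J X) (A : Analyst X S) (s : S) {n : ℕ} (x : Fin n → X)
    {q : ℕ} (z : Fin q → ℝ) (k : Fin q) :
    noisyAnswers M A s x z k =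
      M.posteriorMean x (A.asked s (noisyAnswers M A s x z) k) + z k := by
  induction q with
  | zero => exact k.elim0
  | succ q ih =>
    induction k using Fin.lastCases with
    | last =>
      have h : (fun i : Fin q => noisyAnswers M A s x z (Fin.castSucc i)) =
          noisyAnswers M A s x (Fin.init z) := by
        funext i
        simp [noisyAnswers]
      have h' : A.asked s (noisyAnswers M A s x z) (Fin.last q) =
          A.query q s (noisyAnswers M A s x (Fin.init z)) := by
        rw [← h]; rfl
      rw [h']
      simp [noisyAnswers]
    | cast k =>
      have h : ∀ i : Fin q, noisyAnswers M A s x z (Fin.castSucc i) =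
          noisyAnswers M A s x (Fin.init z) i := by
        intro i
        simp [noisyAnswers]
      have h' : A.asked s (noisyAnswers M A s x z) k.castSucc =
          A.asked s (noisyAnswers M A s x (Fin.init z)) k := by
        unfold Analyst.asked
        congr 1
        funext i
        exact h (Fin.castLE k.isLt.le i)
      rw [h', h, ih]
      rfl

/-- The noise variance `1 / (4 n)`. -/
def noiseVariance (n : ℕ) : ℝ≥0 := 1 / (4 * (n : ℝ≥0))

/-- The joint law of hypothesis, samples, seed and noises in the game with `n` samples and `q`
queries: the hypothesis `j` is drawn from the prior, and given `j` the `n` samples are independent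
draws from `hyp j`, the seed has law `ρ`, the noises are `q` independent `N(0, 1 / (4 n))`
variables, and samples, seed and noises are independent. -/
def gameLaw [MeasurableSpace J] [MeasurableSpace X] (M : Model J X) (ρ : Measure S) (n q : ℕ) :
    Measure (J × (Fin n → X) × S × (Fin q → ℝ)) :=
  ∑ j, M.prior j •
    (Measure.dirac j).prod
      ((Measure.pi fun _ : Fin n => (M.hyp j).toMeasure).prod
        (ρ.prod (Measure.pi fun _ : Fin q => gaussianReal 0 (noiseVariance n))))

/-- The event that all `q` answers are `ε`-accurate for the true hypothesis. -/
def allAccurate (M : Model J X) (A : Analyst X S) (n q : ℕ) (ε : ℝ) :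
    Set (J × (Fin n → X) × S × (Fin q → ℝ)) :=
  {ω | ∀ k : Fin q,
    |mean (M.hyp ω.1) (A.asked ω.2.2.1 (noisyAnswers M A ω.2.2.1 ω.2.1 ω.2.2.2) k) -
      noisyAnswers M A ω.2.2.1 ω.2.1 ω.2.2.2 k| < ε}

end Game

/-- The linear classification model `LC_m` on `𝔽₂^m × 𝔽₂`: uniformly random coefficients
`(a, b)` are drawn, and the hypothesis is the uniform distribution on the graph of
`y ↦ a + ∑ k, b k * y k`. -/
def linearClassification (m : ℕ) :
    Model (ZMod 2 × (Fin m → ZMod 2)) ((Fin m → ZMod 2) × ZMod 2) where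
  prior := PMF.uniformOfFintype _
  hyp c := (PMF.uniformOfFintype (Fin m → ZMod 2)).map fun y => (y, c.1 + ∑ k, c.2 k * y k)

end AdaptiveData

end

namespace AdaptiveData

/-! The samples either reveal the hypothesis or no query can exploit them. If `n > 2m`, a wrong
affine function agrees with the true one on at most half of the points, so it survives all samples
with probability at most `2⁻ⁿ`. A union bound over the `2 · 2ᵐ` functions
(`linearClassification_undeterminedProb_le`) shows that the posterior is almost surely a point mass
up to probability `2 · 2^(m-n)`; then only the noise causes error. If `n ≤ 2m`, orthogonality of
sign characters gives every query prior variance at most `2⁻ᵐ/4`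
(`linearClassification_variance_le`), exponentially small in `n`. The posterior mean is then so
close to the prior mean that the noise hides the difference: a hybrid argument
(`lintegral_respond_le`) replaces it, round by round, by the prior mean. Against that surrogate the
transcript is independent of hypothesis and samples, so adaptivity is harmless and Chebyshev applies
to each query. Both regimes give failure probability at most `32 q exp(-nε²/16)`
(`gameLaw_compl_allAccurate_le`). This proves the theorem unless `q/δ < 2`, that is `q = 1` and `δ >
1/2`. There `log (q/δ)` may be near `0` and `n` may lie far below `1/ε²`, so when `nε²` is bounded a
lower bound on the success probability of order `ε√n` is used instead
(`le_gameLaw_allAccurate_one`). -/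

/-! ### Gaussian estimates: shifts, tails, small balls. -/

/-- The ratio of the densities is an exponential, and `exp (-s) ≥ 1 - s`. The error is weighted by
the density centred at `u`, so that integrating it needs only central moments. -/
lemma gaussianPDFReal_sub_le (u w t : ℝ) {v : ℝ≥0} (hv : v ≠ 0) :
    gaussianPDFReal u v t ≤ gaussianPDFReal w v t +
      gaussianPDFReal u v t * ((|u - w| * |t - u| + (u - w) ^ 2 / 2) / v) := by
  have hv' : (0 : ℝ) < v := by positivity
  have hratio : gaussianPDFReal w v t = gaussianPDFReal u v t *
      Real.exp (-((u - w) * (t - u) + (u - w) ^ 2 / 2) / v) := by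
    simp only [gaussianPDFReal]
    rw [mul_assoc _ (Real.exp _) (Real.exp _), ← Real.exp_add]
    congr 2
    field_simp
    ring
  have h1 := Real.add_one_le_exp (-((u - w) * (t - u) + (u - w) ^ 2 / 2) / v)
  have h2 : ((u - w) * (t - u) + (u - w) ^ 2 / 2) / v ≤
      (|u - w| * |t - u| + (u - w) ^ 2 / 2) / v := by
    refine div_le_div_of_nonneg_right (add_le_add_left ?_ _) hv'.le
    rw [← abs_mul]
    exact le_abs_self _
  rw [hratio, ← mul_add]
  refine le_mul_of_one_le_right (gaussianPDFReal_nonneg _ _ _) ?_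
  rw [neg_div] at h1
  rw [neg_div]
  linarith

lemma lintegral_add_mul_sq_gaussianReal (u : ℝ) (v : ℝ≥0) {a b : ℝ} (ha : 0 ≤ a) (hb : 0 ≤ b) :
    ∫⁻ t, ENNReal.ofReal (a + b * (t - u) ^ 2) ∂(gaussianReal u v) =
      ENNReal.ofReal (a + b * v) := by
  have hint : Integrable (fun t : ℝ => (t - u) ^ 2) (gaussianReal u v) :=
    ((memLp_id_gaussianReal 2).sub (memLp_const u)).integrable_sq
  have hvar : ∫ t, (t - u) ^ 2 ∂(gaussianReal u v) = v := by
    have h := variance_fun_id_gaussianReal (μ := u) (v := v)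
    rw [variance_eq_integral (by fun_prop)] at h
    simpa using h
  rw [← ofReal_integral_eq_lintegral_ofReal]
  · rw [integral_add (integrable_const _) (hint.const_mul b), integral_const_mul, hvar]
    simp
  · exact (integrable_const _).add (hint.const_mul b)
  · exact Filter.Eventually.of_forall fun t => by positivity

/-- One-sided total variation bound between two translates of a centered Gaussian. -/
lemma lintegral_gaussianReal_shift_le {v : ℝ≥0} (hv : v ≠ 0) {G : ℝ → ℝ≥0∞} (hG : Measurable G)
    (hG1 : ∀ t, G t ≤ 1) (u w : ℝ) :
    ∫⁻ t, G (u + t) ∂(gaussianReal 0 v) ≤ ∫⁻ t, G (w + t) ∂(gaussianReal 0 v) +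
      ENNReal.ofReal (|u - w| / √v + (u - w) ^ 2 / (2 * v)) := by
  have hv' : (0 : ℝ) < v := by positivity
  have hs : (0 : ℝ) < √v := by positivity
  have key : ∀ c : ℝ, ∫⁻ t, G (c + t) ∂(gaussianReal 0 v) =
      ∫⁻ t, gaussianPDF c v t * G t := by
    intro c
    have h := gaussianReal_map_const_add (μ := 0) (v := v) c
    rw [zero_add] at h
    rw [← lintegral_map hG (measurable_const_add c), h, gaussianReal_of_var_ne_zero _ hv,
      lintegral_withDensity_eq_lintegral_mul _ (measurable_gaussianPDF c v) hG]
    rfl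
  rw [key, key]
  -- AM-GM bounds `|t - u| / v` by `1 / (2√v) + (t - u)² / (2√v v)`, trading the absolute first
  -- moment for the variance; `a` and `b` collect the resulting coefficients.
  set a : ℝ := |u - w| / (2 * √v) + (u - w) ^ 2 / (2 * v) with ha
  set b : ℝ := |u - w| / (2 * √v) / v with hb
  have ha0 : 0 ≤ a := by positivity
  have hb0 : 0 ≤ b := by positivity
  have hab : a + b * v = |u - w| / √v + (u - w) ^ 2 / (2 * v) := by
    rw [ha, hb]; field_simp; ring
  have hpt : ∀ t, gaussianPDF u v t * G t ≤
      gaussianPDF w v t * G t + gaussianPDF u v t * ENNReal.ofReal (a + b * (t - u) ^ 2) := by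
    intro t
    have hle : (|u - w| * |t - u| + (u - w) ^ 2 / 2) / v ≤ a + b * (t - u) ^ 2 := by
      have h3 : |t - u| / v ≤ 1 / (2 * √v) + (t - u) ^ 2 / (2 * √v) / v := by
        have h4 : 1 / (2 * √(v : ℝ)) + (t - u) ^ 2 / (2 * √v) / v - |t - u| / v =
            (√v - |t - u|) ^ 2 / (2 * √v * v) := by
          rw [← sq_abs (t - u), sub_sq, Real.sq_sqrt hv'.le]
          field_simp
          ring
        have : 0 ≤ (√(v : ℝ) - |t - u|) ^ 2 / (2 * √v * v) := by positivity
        linarith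
      have h5 := mul_le_mul_of_nonneg_left h3 (abs_nonneg (u - w))
      have e1 : (|u - w| * |t - u| + (u - w) ^ 2 / 2) / v =
          |u - w| * (|t - u| / v) + (u - w) ^ 2 / (2 * v) := by field_simp
      have e2 : a + b * (t - u) ^ 2 = |u - w| * (1 / (2 * √v) + (t - u) ^ 2 / (2 * √v) / v) +
          (u - w) ^ 2 / (2 * v) := by rw [ha, hb]; field_simp; ring
      rw [e1, e2]
      linarith
    have h1 : gaussianPDF u v t ≤
        gaussianPDF w v t + gaussianPDF u v t * ENNReal.ofReal (a + b * (t - u) ^ 2) := by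
      simp only [gaussianPDF]
      rw [← ENNReal.ofReal_mul (gaussianPDFReal_nonneg _ _ _),
        ← ENNReal.ofReal_add (gaussianPDFReal_nonneg _ _ _)
          (mul_nonneg (gaussianPDFReal_nonneg _ _ _) (by positivity))]
      refine ENNReal.ofReal_le_ofReal ((gaussianPDFReal_sub_le u w t hv).trans ?_)
      gcongr
      exact gaussianPDFReal_nonneg _ _ _
    calc gaussianPDF u v t * G t
        ≤ (gaussianPDF w v t + gaussianPDF u v t * ENNReal.ofReal (a + b * (t - u) ^ 2)) * G t := by
          gcongr
      _ ≤ _ := by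
          rw [add_mul]
          exact add_le_add le_rfl (mul_le_of_le_one_right zero_le (hG1 t))
  refine (lintegral_mono hpt).trans ?_
  rw [lintegral_add_left (f := fun t => gaussianPDF w v t * G t)
    ((measurable_gaussianPDF w v).mul hG)]
  gcongr
  rw [← hab, ← lintegral_add_mul_sq_gaussianReal u v ha0 hb0, gaussianReal_of_var_ne_zero _ hv,
    lintegral_withDensity_eq_lintegral_mul _ (measurable_gaussianPDF u v) (by fun_prop)]
  rfl

lemma gaussianReal_abs_ge_le (v : ℝ≥0) {r : ℝ} (hr : 0 ≤ r) :
    gaussianReal 0 v {t | r ≤ |t|} ≤ ENNReal.ofReal (2 * Real.exp (-r ^ 2 / (2 * v))) := by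
  have hsub : HasSubgaussianMGF (fun t : ℝ => t) v (gaussianReal 0 v) :=
    ⟨fun t => integrable_exp_mul_gaussianReal t, fun t => by
      rw [mgf_fun_id_gaussianReal]; simp⟩
  have h1 := hsub.measure_ge_le hr
  have h2 := hsub.neg.measure_ge_le hr
  have hsplit : {t : ℝ | r ≤ |t|} ⊆ {t | r ≤ t} ∪ {t | r ≤ (-fun t : ℝ => t) t} := by
    intro t ht
    exact le_abs.1 (Set.mem_ofPred_eq ▸ ht)
  refine (measure_mono hsplit).trans ((measure_union_le _ _).trans ?_)
  rw [two_mul, ENNReal.ofReal_add (by positivity) (by positivity)]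
  gcongr
  · rw [← ofReal_measureReal]; exact ENNReal.ofReal_le_ofReal h1
  · rw [← ofReal_measureReal]; exact ENNReal.ofReal_le_ofReal h2

/-- Length of the interval times a lower bound for the density: on the ball `t² ≤ 2(D² + r²)`. -/
lemma le_gaussianReal_ball {v : ℝ≥0} (hv : v ≠ 0) (D r : ℝ) :
    ENNReal.ofReal (2 * r * ((√(2 * Real.pi * v))⁻¹ * Real.exp (-(D ^ 2 + r ^ 2) / v))) ≤
      gaussianReal 0 v {t | |t - D| < r} := by
  have hv' : (0 : ℝ) < v := by positivity
  have hset : {t : ℝ | |t - D| < r} = Metric.ball D r := by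
    ext t; simp [Metric.mem_ball, Real.dist_eq]
  rw [hset, gaussianReal_apply _ hv]
  calc ENNReal.ofReal (2 * r * ((√(2 * Real.pi * v))⁻¹ * Real.exp (-(D ^ 2 + r ^ 2) / v)))
      = ∫⁻ _ in Metric.ball D r,
          ENNReal.ofReal ((√(2 * Real.pi * v))⁻¹ * Real.exp (-(D ^ 2 + r ^ 2) / v)) := by
        rw [setLIntegral_const, Real.volume_ball, ← ENNReal.ofReal_mul (by positivity), mul_comm]
    _ ≤ ∫⁻ t in Metric.ball D r, gaussianPDF 0 v t := by
        refine setLIntegral_mono (measurable_gaussianPDF 0 v) fun t ht => ?_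
        rw [gaussianPDF, gaussianPDFReal_def]
        refine ENNReal.ofReal_le_ofReal ?_
        dsimp only
        gcongr ?_ * Real.exp ?_
        rw [Metric.mem_ball, Real.dist_eq] at ht
        rw [neg_div, neg_div, neg_le_neg_iff, div_le_div_iff₀ (by positivity) hv']
        have h1 : (t - D) ^ 2 ≤ r ^ 2 := by
          rw [← sq_abs]; gcongr
        -- `2(t - D)² + 2D² - t² = (t - 2D)²`.
        nlinarith [sq_nonneg (t - D - D)]

/-! ### Transcripts and the hybrid argument. -/

section Respond

variable {X : Type} {S : Type*} [MeasurableSpace S]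

/-- The transcript of an analyst against a curator who answers the query `f` with `r f` plus
noise. -/
def respond (r : (X → unitInterval) → ℝ) (A : Analyst X S) (s : S) :
    {q : ℕ} → (Fin q → ℝ) → (Fin q → ℝ)
  | 0, _ => Fin.elim0
  | q + 1, z =>
    let past : Fin q → ℝ := respond r A s (Fin.init z)
    Fin.snoc past (r (A.query q s past) + z (Fin.last q))

/-- The samples enter only through a map from queries to answers, which can thus be exchanged for
one that ignores them. -/
lemma noisyAnswers_eq_respond {J : Type} [Fintype J] [Fintype X] (M : Model J X)
    (A : Analyst X S) (s : S) {n : ℕ} (x : Fin n → X) {q : ℕ} (z : Fin q → ℝ) :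
    noisyAnswers M A s x z = respond (M.posteriorMean x) A s z := by
  induction q with
  | zero => exact funext fun k => k.elim0
  | succ q ih => simp only [noisyAnswers, respond, ih]

variable (r : (X → unitInterval) → ℝ) (A : Analyst X S) (s : S) {q : ℕ}

lemma respond_snoc (z : Fin q → ℝ) (t : ℝ) :
    respond r A s (Fin.snoc z t : Fin (q + 1) → ℝ) =
      Fin.snoc (respond r A s z) (r (A.query q s (respond r A s z)) + t) := by
  simp [respond]

lemma asked_snoc_castSucc (a : Fin q → ℝ) (t : ℝ) (k : Fin q) :
    A.asked s (Fin.snoc a t : Fin (q + 1) → ℝ) k.castSucc = A.asked s a k := by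
  unfold Analyst.asked
  congr 1
  funext i
  exact Fin.snoc_castSucc (α := fun _ => ℝ) t a (Fin.castLE k.isLt.le i)

lemma asked_snoc_last (a : Fin q → ℝ) (t : ℝ) :
    A.asked s (Fin.snoc a t : Fin (q + 1) → ℝ) (Fin.last q) = A.query q s a := by
  unfold Analyst.asked
  congr 1
  funext i
  exact Fin.snoc_castSucc (α := fun _ => ℝ) t a i

lemma respond_apply (z : Fin q → ℝ) (k : Fin q) :
    respond r A s z k = r (A.asked s (respond r A s z) k) + z k := by
  induction q with
  | zero => exact k.elim0
  | succ q ih =>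
    rw [← Fin.snoc_init_self z, respond_snoc]
    induction k using Fin.lastCases with
    | last => rw [asked_snoc_last]; simp
    | cast k => rw [asked_snoc_castSucc, Fin.snoc_castSucc, ih]; simp

lemma Analyst.measurable_asked (k : Fin q) :
    Measurable fun p : S × (Fin q → ℝ) => A.asked p.1 p.2 k := by
  refine measurable_pi_iff.2 fun x => ?_
  refine (A.measurable_query k x).comp
    (f := fun p : S × (Fin q → ℝ) => (p.1, fun i : Fin k => p.2 (Fin.castLE k.isLt.le i))) ?_
  fun_prop

variable {r} in
lemma measurable_respond (hr : Measurable r) :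
    Measurable fun p : S × (Fin q → ℝ) => respond r A p.1 p.2 := by
  induction q with
  | zero => exact measurable_pi_iff.2 fun k => k.elim0
  | succ q ih =>
    have hpast : Measurable fun p : S × (Fin (q + 1) → ℝ) =>
        (p.1, respond r A p.1 (Fin.init p.2)) := by
      refine measurable_fst.prodMk (ih.comp (measurable_fst.prodMk ?_))
      exact measurable_pi_iff.2 fun i => (measurable_pi_apply _).comp measurable_snd
    refine measurable_pi_iff.2 fun k => ?_
    induction k using Fin.lastCases with
    | last =>
      simp only [respond, Fin.snoc_last]
      refine (hr.comp (measurable_pi_iff.2 fun x => ?_)).add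
        ((measurable_pi_apply _).comp measurable_snd)
      exact (A.measurable_query q x).comp hpast
    | cast k =>
      simp only [respond, Fin.snoc_castSucc]
      exact (measurable_pi_apply k).comp (measurable_snd.comp hpast)

lemma lintegral_pi_snoc (γ : Measure ℝ) [SigmaFinite γ] {H : (Fin (q + 1) → ℝ) → ℝ≥0∞}
    (hH : Measurable H) :
    ∫⁻ z, H z ∂(Measure.pi fun _ : Fin (q + 1) => γ) =
      ∫⁻ z, ∫⁻ t, H (Fin.snoc z t) ∂γ ∂(Measure.pi fun _ : Fin q => γ) := by
  have h := (measurePreserving_piFinSuccAbove (fun _ : Fin (q + 1) => γ) (Fin.last q)).symm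
  rw [← h.lintegral_comp hH, lintegral_prod_symm
    (fun p => H ((MeasurableEquiv.piFinSuccAbove (fun _ => ℝ) (Fin.last q)).symm p))
    (hH.comp (MeasurableEquiv.measurable _)).aemeasurable]
  refine lintegral_congr fun z => lintegral_congr fun t => ?_
  congr 1
  simp [MeasurableEquiv.piFinSuccAbove_symm_apply, Fin.insertNthEquiv, Fin.insertNth_last']

/-- The price of replacing the answer `r f` by `b f` under Gaussian noise of variance `v`. -/
noncomputable def swapCost (v : ℝ≥0) (r b : (X → unitInterval) → ℝ) (f : X → unitInterval) :
    ℝ≥0∞ :=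
  ENNReal.ofReal (|r f - b f| / √v + (r f - b f) ^ 2 / (2 * v))

/-- Hybrid argument: one may replace the answers `r` by `b` at the total cost of the queries
asked against `b`. -/
lemma lintegral_respond_le {v : ℝ≥0} (hv : v ≠ 0) {b : (X → unitInterval) → ℝ}
    (hr : Measurable r) (hb : Measurable b) {F : (Fin q → ℝ) → ℝ≥0∞} (hF : Measurable F)
    (hF1 : ∀ a, F a ≤ 1) :
    ∫⁻ z, F (respond r A s z) ∂(Measure.pi fun _ : Fin q => gaussianReal 0 v) ≤
      ∫⁻ z, (F (respond b A s z) + ∑ k, swapCost v r b (A.asked s (respond b A s z) k))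
        ∂(Measure.pi fun _ : Fin q => gaussianReal 0 v) := by
  have hcost : Measurable (swapCost v r b) := by unfold swapCost; fun_prop
  have hresp : ∀ {r : (X → unitInterval) → ℝ}, Measurable r → ∀ q,
      Measurable fun z : Fin q → ℝ => respond r A s z := fun hr q =>
    (measurable_respond A hr).comp (measurable_const.prodMk measurable_id)
  have hasked : ∀ {q} (k : Fin q), Measurable fun a : Fin q → ℝ => A.asked s a k := fun k =>
    (A.measurable_asked k).comp (measurable_const.prodMk measurable_id)
  have hquery : ∀ q, Measurable fun a : Fin q → ℝ => A.query q s a := fun q =>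
    measurable_pi_iff.2 fun x =>
      (A.measurable_query q x).comp (measurable_const.prodMk measurable_id)
  have hsnoc : ∀ {q}, Measurable fun p : (Fin q → ℝ) × ℝ =>
      (Fin.snoc p.1 p.2 : Fin (q + 1) → ℝ) := by
    intro q
    refine measurable_pi_iff.2 fun k => ?_
    induction k using Fin.lastCases with
    | last => simpa using measurable_snd
    | cast k =>
      simp only [Fin.snoc_castSucc]
      exact (measurable_pi_apply k).comp measurable_fst
  induction q with
  | zero =>
    refine lintegral_mono fun z => le_add_right ?_
    rw [Subsingleton.elim (respond r A s z) (respond b A s z)]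
  | succ q ih =>
    -- With the last noise integrated out, `F` becomes a test function of the first `q` answers,
    -- again bounded by `1`, so the induction hypothesis applies to it.
    have hstep : ∀ {r : (X → unitInterval) → ℝ}, Measurable r →
        Measurable fun a : Fin q → ℝ => ∫⁻ t, F (Fin.snoc a (r (A.query q s a) + t))
          ∂(gaussianReal 0 v) := by
      intro r hr
      refine Measurable.lintegral_prod_right'
        (f := fun p : (Fin q → ℝ) × ℝ => F (Fin.snoc p.1 (r (A.query q s p.1) + p.2))) ?_
      refine hF.comp (hsnoc.comp (measurable_fst.prodMk ?_))
      exact ((hr.comp (hquery q)).comp measurable_fst).add measurable_snd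
    have hstep1 : ∀ a : Fin q → ℝ, ∫⁻ t, F (Fin.snoc a (r (A.query q s a) + t))
        ∂(gaussianReal 0 v) ≤ 1 := fun a =>
      (lintegral_mono fun t => hF1 _).trans (by simp)
    rw [lintegral_pi_snoc (H := fun z => F (respond r A s z)) _ (hF.comp (hresp hr _)),
      lintegral_pi_snoc]
    · simp_rw [respond_snoc, Fin.sum_univ_castSucc, asked_snoc_castSucc, asked_snoc_last]
      -- The earlier rounds are swapped first; hence the last swap is charged at the query asked
      -- after a transcript against `b`.
      refine (ih (hstep hr) hstep1).trans (lintegral_mono fun z => ?_)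
      dsimp only
      set a := respond b A s z
      rw [lintegral_add_right _ measurable_const, lintegral_const, measure_univ, mul_one,
        add_comm (∑ k, _) _, ← add_assoc]
      gcongr
      refine lintegral_gaussianReal_shift_le (G := fun t => F (Fin.snoc a t)) hv ?_
        (fun t => hF1 _) _ _
      exact hF.comp (hsnoc.comp (measurable_const.prodMk measurable_id))
    · exact (hF.comp (hresp hb _)).add
        (Finset.measurable_sum _ fun k _ => hcost.comp ((hasked k).comp (hresp hb _)))

end Respond

/-! ### Bayesian weights and the bias-variance identity. -/

section Weights

lemma Model.jointWeight_nonneg {J X : Type} (M : Model J X) {n : ℕ}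
    (x : Fin n → X) (j : J) : 0 ≤ M.jointWeight x j :=
  mul_nonneg ENNReal.toReal_nonneg (Finset.prod_nonneg fun _ _ => ENNReal.toReal_nonneg)

variable {J X : Type} [Fintype X]

lemma sum_toReal_eq_one (p : PMF X) : ∑ x, (p x).toReal = 1 := by
  rw [← ENNReal.toReal_sum fun x _ => p.apply_ne_top x, ← tsum_fintype (L := .unconditional _),
    p.tsum_coe, ENNReal.toReal_one]

lemma measurable_mean (p : PMF X) : Measurable (mean p) := by
  unfold mean
  exact Finset.measurable_sum _ fun x _ =>
    (measurable_subtype_coe.comp (measurable_pi_apply x)).const_mul _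

lemma mean_nonneg (p : PMF X) (f : X → unitInterval) : 0 ≤ mean p f :=
  Finset.sum_nonneg fun x _ => mul_nonneg ENNReal.toReal_nonneg (f x).2.1

lemma mean_le_one (p : PMF X) (f : X → unitInterval) : mean p f ≤ 1 := by
  rw [← sum_toReal_eq_one p]
  exact Finset.sum_le_sum fun x _ => mul_le_of_le_one_right ENNReal.toReal_nonneg (f x).2.2

namespace Model

variable (M : Model J X) {n : ℕ}

lemma sum_jointWeight (j : J) :
    ∑ x : Fin n → X, M.jointWeight x j = (M.prior j).toReal := by
  classical
  simp only [jointWeight]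
  rw [← Finset.mul_sum, ← Fintype.prod_sum (fun (_ : Fin n) y => (M.hyp j y).toReal)]
  simp [sum_toReal_eq_one]

variable [Fintype J]

lemma measurable_posteriorMean (x : Fin n → X) : Measurable (M.posteriorMean x) := by
  unfold posteriorMean
  exact Finset.measurable_sum _ fun j _ => (measurable_mean _).const_mul _

lemma sum_sum_jointWeight : ∑ j, ∑ x : Fin n → X, M.jointWeight x j = 1 := by
  simp_rw [sum_jointWeight, sum_toReal_eq_one]

/-- Bias-variance decomposition of the posterior second moment. -/
lemma sum_jointWeight_mul_sq (x : Fin n → X) (f : X → unitInterval) (b : ℝ) :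
    ∑ j, M.jointWeight x j * (mean (M.hyp j) f - b) ^ 2 =
      ∑ j, M.jointWeight x j * (mean (M.hyp j) f - M.posteriorMean x f) ^ 2 +
        ∑ j, M.jointWeight x j * (M.posteriorMean x f - b) ^ 2 := by
  have hpost : (∑ j, M.jointWeight x j) * M.posteriorMean x f =
      ∑ j, M.jointWeight x j * mean (M.hyp j) f := by
    -- For impossible samples the posterior weights are `0 / 0 = 0`, but all joint weights vanish
    -- too.
    by_cases h : ∑ j, M.jointWeight x j = 0
    · have h0 := (Finset.sum_eq_zero_iff_of_nonneg fun j _ => M.jointWeight_nonneg x j).1 h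
      rw [h, zero_mul, Finset.sum_eq_zero fun j hj => by rw [h0 j hj, zero_mul]]
    · simp only [posteriorMean, posteriorWeight, Finset.mul_sum]
      exact Finset.sum_congr rfl fun j _ => by field_simp
  have hcross : ∑ j, M.jointWeight x j * (mean (M.hyp j) f - M.posteriorMean x f) = 0 := by
    simp_rw [mul_sub, Finset.sum_sub_distrib, ← Finset.sum_mul]
    rw [hpost, sub_self]
  rw [← Finset.sum_add_distrib, ← sub_eq_zero, ← Finset.sum_sub_distrib]
  rw [← mul_zero (2 * (M.posteriorMean x f - b)), ← hcross, Finset.mul_sum]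
  exact Finset.sum_congr rfl fun j _ => by ring

/-- Both terms on the left are nonnegative, so the prior spread around `b` bounds the error of the
posterior mean as well as its distance from `b`. -/
lemma posteriorMean_sq_error_add (f : X → unitInterval) (b : ℝ) :
    ∑ j, ∑ x : Fin n → X, M.jointWeight x j * (mean (M.hyp j) f - M.posteriorMean x f) ^ 2 +
      ∑ j, ∑ x : Fin n → X, M.jointWeight x j * (M.posteriorMean x f - b) ^ 2 =
    ∑ j, (M.prior j).toReal * (mean (M.hyp j) f - b) ^ 2 := by
  simp_rw [← M.sum_jointWeight (n := n), Finset.sum_mul]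
  rw [Finset.sum_comm, Finset.sum_comm (f := fun j (x : Fin n → X) =>
    M.jointWeight x j * (M.posteriorMean x f - b) ^ 2), ← Finset.sum_add_distrib,
    Finset.sum_comm (f := fun j (x : Fin n → X) => M.jointWeight x j * (mean (M.hyp j) f - b) ^ 2)]
  exact Finset.sum_congr rfl fun x _ => (M.sum_jointWeight_mul_sq x f b).symm

lemma posteriorMean_mem_Icc (x : Fin n → X) (f : X → unitInterval) :
    M.posteriorMean x f ∈ Set.Icc (0 : ℝ) 1 := by
  have hw : ∀ j, 0 ≤ M.posteriorWeight x j := fun j =>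
    div_nonneg (M.jointWeight_nonneg x j) (Finset.sum_nonneg fun j _ => M.jointWeight_nonneg x j)
  refine ⟨Finset.sum_nonneg fun j _ => mul_nonneg (hw j) (mean_nonneg _ _), ?_⟩
  calc M.posteriorMean x f ≤ ∑ j, M.posteriorWeight x j :=
        Finset.sum_le_sum fun j _ => mul_le_of_le_one_right (hw j) (mean_le_one _ _)
    _ ≤ 1 := by
        simp only [posteriorWeight, ← Finset.sum_div]
        exact div_self_le_one _

lemma sq_error_le_one (x : Fin n → X) (j : J) (f : X → unitInterval) :
    (mean (M.hyp j) f - M.posteriorMean x f) ^ 2 ≤ 1 := by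
  have h1 := mean_nonneg (M.hyp j) f
  have h2 := mean_le_one (M.hyp j) f
  have h3 := M.posteriorMean_mem_Icc x f
  rw [sq_le_one_iff_abs_le_one, abs_le]
  constructor <;> linarith [h3.1, h3.2]

lemma sum_ofReal_jointWeight_mul_ofReal {h : J → (Fin n → X) → ℝ} (h0 : ∀ j x, 0 ≤ h j x) :
    ∑ j, ∑ x, ENNReal.ofReal (M.jointWeight x j) * ENNReal.ofReal (h j x) =
      ENNReal.ofReal (∑ j, ∑ x, M.jointWeight x j * h j x) := by
  have h1 : ∀ j x, 0 ≤ M.jointWeight x j * h j x := fun j x =>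
    mul_nonneg (M.jointWeight_nonneg x j) (h0 j x)
  rw [ENNReal.ofReal_sum_of_nonneg fun j _ => Finset.sum_nonneg fun x _ => h1 j x]
  refine Finset.sum_congr rfl fun j _ => ?_
  rw [ENNReal.ofReal_sum_of_nonneg fun x _ => h1 j x]
  exact Finset.sum_congr rfl fun x _ => (ENNReal.ofReal_mul (M.jointWeight_nonneg x j)).symm

lemma sum_ofReal_jointWeight : ∑ j, ∑ x : Fin n → X, ENNReal.ofReal (M.jointWeight x j) = 1 := by
  have h := M.sum_ofReal_jointWeight_mul_ofReal (n := n) (h := fun _ _ => 1)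
    (fun _ _ => zero_le_one)
  simpa [M.sum_sum_jointWeight] using h

/-- The probability that the posterior mean is not the mean under the true hypothesis, for some
query. -/
noncomputable def undeterminedProb (n : ℕ) : ℝ :=
  open Classical in
  ∑ j, ∑ x : Fin n → X, M.jointWeight x j *
    if ∃ f, M.posteriorMean x f ≠ mean (M.hyp j) f then 1 else 0

lemma sum_sq_error_le_undeterminedProb (f : X → unitInterval) :
    ∑ j, ∑ x : Fin n → X, M.jointWeight x j * (mean (M.hyp j) f - M.posteriorMean x f) ^ 2 ≤
      M.undeterminedProb n := by
  refine Finset.sum_le_sum fun j _ => Finset.sum_le_sum fun x _ => ?_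
  refine mul_le_mul_of_nonneg_left ?_ (M.jointWeight_nonneg x j)
  split_ifs with h
  · exact M.sq_error_le_one x j f
  · push Not at h
    simp [h f]

end Model

end Weights

/-! ### Measurability of the accuracy event and the law of the game. -/

section Accurate

variable {J X : Type} [Fintype J] [Fintype X] {S : Type*} [MeasurableSpace S] (M : Model J X)
  (A : Analyst X S) {n q : ℕ}

lemma measurableSet_allAccurate_section (ε : ℝ) (j : J) (x : Fin n → X) :
    MeasurableSet {p : S × (Fin q → ℝ) | (j, x, p) ∈ allAccurate M A n q ε} := by
  have hresp : Measurable fun p : S × (Fin q → ℝ) => noisyAnswers M A p.1 x p.2 := by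
    simp_rw [noisyAnswers_eq_respond]
    exact measurable_respond A (M.measurable_posteriorMean x)
  have : {p : S × (Fin q → ℝ) | (j, x, p) ∈ allAccurate M A n q ε} =
      ⋂ k, {p | |mean (M.hyp j) (A.asked p.1 (noisyAnswers M A p.1 x p.2) k) -
        noisyAnswers M A p.1 x p.2 k| < ε} := by
    ext p; simp [allAccurate]
  rw [this]
  refine MeasurableSet.iInter fun k => measurableSet_lt (Measurable.abs (Measurable.sub ?_ ?_))
    measurable_const
  · exact (measurable_mean _).comp ((A.measurable_asked k).comp (measurable_fst.prodMk hresp))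
  · exact (measurable_pi_apply k).comp hresp

end Accurate

section GameLaw

variable {J X : Type} [Fintype J] [Fintype X] [MeasurableSpace J] [MeasurableSpace X]
  [MeasurableSingletonClass J] [MeasurableSingletonClass X]
  {S : Type*} [MeasurableSpace S] (M : Model J X) (ρ : Measure S) [IsProbabilityMeasure ρ]
  {n q : ℕ}

/-- Hypotheses and samples form a finite discrete space, so measurability of the sections suffices
and that part of the law is a sum of atoms. -/
lemma gameLaw_apply {E : Set (J × (Fin n → X) × S × (Fin q → ℝ))}
    (hE : ∀ j x, MeasurableSet {p : S × (Fin q → ℝ) | (j, x, p) ∈ E}) :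
    gameLaw M ρ n q E = ∑ j, ∑ x, ENNReal.ofReal (M.jointWeight x j) *
      ∫⁻ s, (Measure.pi fun _ : Fin q => gaussianReal 0 (noiseVariance n))
        {z | (j, x, s, z) ∈ E} ∂ρ := by
  have hmeas : MeasurableSet E := by
    have : E = ⋃ j, ⋃ x, {ω | ω.1 = j ∧ ω.2.1 = x ∧ (j, x, ω.2.2) ∈ E} := by
      ext ⟨j, x, p⟩
      simp
    rw [this]
    refine MeasurableSet.iUnion fun j => MeasurableSet.iUnion fun x => ?_
    refine (measurable_fst (measurableSet_singleton j)).inter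
      (((measurable_fst.comp measurable_snd) (measurableSet_singleton x)).inter ?_)
    exact (measurable_snd.comp measurable_snd) (hE j x)
  rw [gameLaw, Measure.finsetSum_apply _ _ _]
  refine Finset.sum_congr rfl fun j _ => ?_
  rw [Measure.smul_apply, smul_eq_mul, Measure.dirac_prod,
    Measure.map_apply measurable_prodMk_left hmeas,
    Measure.prod_apply (measurable_prodMk_left hmeas), lintegral_fintype, Finset.mul_sum]
  refine Finset.sum_congr rfl fun x _ => ?_
  rw [Measure.pi_singleton, Measure.prod_apply
    (measurable_prodMk_left (measurable_prodMk_left hmeas)), mul_comm (lintegral _ _), ← mul_assoc]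
  congr 1
  rw [Model.jointWeight, ENNReal.ofReal_mul ENNReal.toReal_nonneg,
    ENNReal.ofReal_toReal (M.prior.apply_ne_top j),
    ENNReal.ofReal_prod_of_nonneg fun _ _ => ENNReal.toReal_nonneg]
  congr 1
  refine Finset.prod_congr rfl fun i _ => ?_
  rw [PMF.toMeasure_apply_singleton _ _ (measurableSet_singleton _),
    ENNReal.ofReal_toReal ((M.hyp j).apply_ne_top _)]

lemma isProbabilityMeasure_gameLaw : IsProbabilityMeasure (gameLaw M ρ n q) := by
  refine ⟨?_⟩
  rw [gameLaw_apply M ρ (E := Set.univ) fun _ _ => MeasurableSet.univ]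
  simp [M.sum_ofReal_jointWeight]

end GameLaw

/-! ### Failure and success bounds for general models. -/

section Bounds

variable {J X : Type} [Fintype J] [Fintype X] [MeasurableSpace J] [MeasurableSpace X]
  [MeasurableSingletonClass J] [MeasurableSingletonClass X]
  {S : Type*} [MeasurableSpace S] (M : Model J X) (ρ : Measure S) [IsProbabilityMeasure ρ]
  (A : Analyst X S) {n q : ℕ}

lemma pi_eval_preimage (γ : Measure ℝ) [IsProbabilityMeasure γ] (k : Fin q) {B : Set ℝ}
    (hB : MeasurableSet B) :
    (Measure.pi fun _ : Fin q => γ) {z | z k ∈ B} = γ B :=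
  (measurePreserving_eval (fun _ : Fin q => γ) k).measure_preimage hB.nullMeasurableSet

lemma noiseVariance_ne_zero (hn : n ≠ 0) : noiseVariance n ≠ 0 := by
  unfold noiseVariance
  positivity

lemma coe_noiseVariance (n : ℕ) : (noiseVariance n : ℝ) = 1 / (4 * n) := by
  simp [noiseVariance]

lemma measurableSet_le_abs (r : ℝ) : MeasurableSet {t : ℝ | r ≤ |t|} :=
  measurableSet_le measurable_const measurable_id.abs

/-- The probability that a given coordinate of the noise is large in absolute value. -/
lemma pi_noise_le (k : Fin q) {r : ℝ} (hr : 0 ≤ r) :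
    (Measure.pi fun _ : Fin q => gaussianReal 0 (noiseVariance n)) {z | r ≤ |z k|} ≤
      ENNReal.ofReal (2 * Real.exp (-(2 * n * r ^ 2))) := by
  refine (pi_eval_preimage _ k (measurableSet_le_abs r)).le.trans
    ((gaussianReal_abs_ge_le _ hr).trans (ENNReal.ofReal_le_ofReal (le_of_eq ?_)))
  rw [coe_noiseVariance]
  congr 2
  by_cases hn : (n : ℝ) = 0
  · simp [hn]
  · field_simp
    ring

/-- If the posterior mean is mostly exact, then only the noise matters. -/
lemma gameLaw_compl_allAccurate_le_of_undeterminedProb {ε : ℝ} (hε : 0 ≤ ε) :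
    gameLaw M ρ n q (allAccurate M A n q ε)ᶜ ≤
      ENNReal.ofReal (M.undeterminedProb n + q * (2 * Real.exp (-(2 * n * ε ^ 2)))) := by
  classical
  rw [gameLaw_apply M ρ fun j x => (measurableSet_allAccurate_section M A ε j x).compl]
  set τ : ℝ := q * (2 * Real.exp (-(2 * n * ε ^ 2))) with hτ
  have hτ0 : 0 ≤ τ := by positivity
  have hbound : ∀ j, ∀ x : Fin n → X, ∫⁻ s,
      (Measure.pi fun _ : Fin q => gaussianReal 0 (noiseVariance n))
        {z | (j, x, s, z) ∈ (allAccurate M A n q ε)ᶜ} ∂ρ ≤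
      ENNReal.ofReal ((if ∃ f, M.posteriorMean x f ≠ mean (M.hyp j) f then 1 else 0) + τ) := by
    intro j x
    refine (lintegral_mono (g := fun _ => ENNReal.ofReal
      ((if ∃ f, M.posteriorMean x f ≠ mean (M.hyp j) f then 1 else 0) + τ)) fun s => ?_).trans
        (by simp)
    dsimp only
    split_ifs with h
    · refine prob_le_one.trans ?_
      rw [← ENNReal.ofReal_one]
      exact ENNReal.ofReal_le_ofReal (by linarith)
    · push Not at h
      -- The posterior mean is exact here, so the error of an answer is its noise.
      have hsub : {z : Fin q → ℝ | (j, x, s, z) ∈ (allAccurate M A n q ε)ᶜ} ⊆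
          ⋃ k, {z | ε ≤ |z k|} := by
        intro z hz
        simp only [allAccurate, Set.mem_compl_iff, Set.mem_ofPred_eq, not_forall, not_lt] at hz
        obtain ⟨k, hk⟩ := hz
        rw [noisyAnswers_apply, h, sub_add_cancel_left, abs_neg] at hk
        exact Set.mem_iUnion.2 ⟨k, hk⟩
      refine (measure_mono hsub).trans ((measure_iUnion_fintype_le _ _).trans ?_)
      refine (Finset.sum_le_sum fun k _ => pi_noise_le k hε).trans (le_of_eq ?_)
      rw [Finset.sum_const, Finset.card_univ, Fintype.card_fin, nsmul_eq_mul, zero_add, hτ,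
        ENNReal.ofReal_mul (Nat.cast_nonneg q), ENNReal.ofReal_natCast]
  refine (Finset.sum_le_sum fun j _ => Finset.sum_le_sum fun x _ =>
    mul_le_mul_right (hbound j x) _).trans ?_
  rw [M.sum_ofReal_jointWeight_mul_ofReal fun j x => by positivity]
  refine ENNReal.ofReal_le_ofReal (le_of_eq ?_)
  simp_rw [mul_add, Finset.sum_add_distrib, ← Finset.sum_mul, M.sum_sum_jointWeight, one_mul]
  rfl

/-- AM-GM with free parameter `θ`: only second moments of `d` are controlled, so the linear term
must be absorbed into a constant and a square. -/
lemma abs_div_sqrt_add_le {θ v : ℝ} (hθ : 0 < θ) (hv : 0 < v) (d : ℝ) :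
    |d| / √v + d ^ 2 / (2 * v) ≤ θ + (1 / (4 * θ * v) + 1 / (2 * v)) * d ^ 2 := by
  have hs : 0 < √v := Real.sqrt_pos.2 hv
  have h : θ + (1 / (4 * θ * v) + 1 / (2 * v)) * d ^ 2 - (|d| / √v + d ^ 2 / (2 * v)) =
      (2 * θ * √v - |d|) ^ 2 / (4 * θ * v) := by
    rw [sub_sq, mul_pow, Real.sq_sqrt hv.le, sq_abs]
    have : |d| / √v = |d| * √v / v := by
      rw [div_eq_div_iff hs.ne' hv.ne', mul_assoc, Real.mul_self_sqrt hv.le]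
    rw [this]
    field_simp
    ring
  have : 0 ≤ (2 * θ * √v - |d|) ^ 2 / (4 * θ * v) := by positivity
  linarith

/-- If no query has large prior variance, then the posterior mean curator is accurate, since his
answers look like noisy prior means. -/
lemma gameLaw_compl_allAccurate_le_of_variance (hn : n ≠ 0) {b : (X → unitInterval) → ℝ}
    (hb : Measurable b) {V : ℝ}
    (hV : ∀ f, ∑ j, (M.prior j).toReal * (mean (M.hyp j) f - b f) ^ 2 ≤ V)
    {ε θ : ℝ} (hε : 0 < ε) (hθ : 0 < θ) :
    gameLaw M ρ n q (allAccurate M A n q ε)ᶜ ≤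
      ENNReal.ofReal (q * (4 / ε ^ 2 * V + θ + (n / θ + 2 * n) * V +
        2 * Real.exp (-(n * ε ^ 2 / 2)))) := by
  classical
  rw [gameLaw_apply M ρ fun j x => (measurableSet_allAccurate_section M A ε j x).compl]
  have hn' : (0 : ℝ) < n := by positivity
  set v := noiseVariance n with hv
  have hv0 : v ≠ 0 := noiseVariance_ne_zero hn
  have hvr : (v : ℝ) = 1 / (4 * n) := coe_noiseVariance n
  have hvpos : (0 : ℝ) < v := by positivity
  set κ : ℝ := 1 / (4 * θ * v) + 1 / (2 * v) with hκ
  have hκ0 : 0 ≤ κ := by positivity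
  have hκn : κ = n / θ + 2 * n := by
    rw [hκ, hvr]
    field_simp
    ring
  set γ := Measure.pi fun _ : Fin q => gaussianReal 0 v with hγ
  -- The first summand is the Chebyshev bound at distance `ε / 2`, the other is the swap cost.
  set h : J → (Fin n → X) → (X → unitInterval) → ℝ := fun j x f =>
    4 / ε ^ 2 * (mean (M.hyp j) f - b f) ^ 2 + (θ + κ * (M.posteriorMean x f - b f) ^ 2) with hh
  have hh0 : ∀ j x f, 0 ≤ h j x f := fun j x f => by positivity
  have hhm : ∀ j x, Measurable (h j x) := fun j x =>
    ((((measurable_mean _).sub hb).pow_const 2).const_mul _).add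
      (((((M.measurable_posteriorMean x).sub hb).pow_const 2).const_mul _).const_add _)
  set g : Fin q → (Fin q → ℝ) → ℝ≥0∞ := fun k =>
    {z : Fin q → ℝ | ε / 2 ≤ |z k|}.indicator 1 with hg
  have hgm : ∀ k, MeasurableSet {z : Fin q → ℝ | ε / 2 ≤ |z k|} := fun k =>
    (measurableSet_le_abs (ε / 2)).preimage (measurable_pi_apply k)
  -- Queries asked against `b` depend on seed and noise only, so the average over `j` and `x` can
  -- later be taken with the query fixed.
  set fk : Fin q → S × (Fin q → ℝ) → X → unitInterval := fun k p =>
    A.asked p.1 (respond b A p.1 p.2) k with hfk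
  have hfkm : ∀ k, Measurable (fk k) := fun k =>
    (A.measurable_asked k).comp (measurable_fst.prodMk (measurable_respond A hb))
  set H : J → (Fin n → X) → S × (Fin q → ℝ) → ℝ≥0∞ := fun j x p =>
    ∑ k, (ENNReal.ofReal (h j x (fk k p)) + g k p.2) with hH
  have hHm : ∀ j x, Measurable (H j x) := fun j x =>
    Finset.measurable_sum _ fun k _ => ((hhm j x).comp (hfkm k)).ennreal_ofReal.add
      ((measurable_one.indicator (hgm k)).comp measurable_snd)
  have hbound : ∀ j, ∀ x : Fin n → X, ∫⁻ s, γ {z | (j, x, s, z) ∈ (allAccurate M A n q ε)ᶜ} ∂ρ ≤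
      ∫⁻ p, H j x p ∂(ρ.prod γ) := by
    intro j x
    rw [lintegral_prod _ (hHm j x).aemeasurable]
    refine lintegral_mono fun s => ?_
    dsimp only
    set B : Set (Fin q → ℝ) := {a | ∃ k, ε ≤ |mean (M.hyp j) (A.asked s a k) - a k|} with hB
    have hBm : MeasurableSet B := by
      have : B = ⋃ k, {a | ε ≤ |mean (M.hyp j) (A.asked s a k) - a k|} := by
        ext a; simp [hB]
      rw [this]
      refine MeasurableSet.iUnion fun k => measurableSet_le measurable_const
        (Measurable.abs (Measurable.sub ?_ (measurable_pi_apply k)))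
      exact (measurable_mean _).comp
        ((A.measurable_asked k).comp (measurable_const.prodMk measurable_id))
    have hset : {z | (j, x, s, z) ∈ (allAccurate M A n q ε)ᶜ} =
        (fun z => respond (M.posteriorMean x) A s z) ⁻¹' B := by
      ext z
      simp [allAccurate, hB, noisyAnswers_eq_respond]
    have hrm : Measurable fun z : Fin q → ℝ => respond (M.posteriorMean x) A s z :=
      (measurable_respond A (M.measurable_posteriorMean x)).comp
        (measurable_const.prodMk measurable_id)
    rw [hset, ← lintegral_indicator_one (hrm hBm)]
    refine (lintegral_respond_le (M.posteriorMean x) A s hv0 (M.measurable_posteriorMean x) hb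
      (F := B.indicator 1) (measurable_one.indicator hBm)
      (fun a => Set.indicator_le_self' (fun _ _ => zero_le) a)).trans
      (lintegral_mono fun z => ?_)
    dsimp only
    have hcost : ∀ k, swapCost v (M.posteriorMean x) b (A.asked s (respond b A s z) k) ≤
        ENNReal.ofReal (θ + κ * (M.posteriorMean x (fk k (s, z)) - b (fk k (s, z))) ^ 2) :=
      fun k => ENNReal.ofReal_le_ofReal (abs_div_sqrt_add_le hθ hvpos _)
    -- An error of at least `ε` forces the noise or the distance of the true mean from `b` to reach
    -- `ε / 2`.
    have hind : B.indicator 1 (respond b A s z) ≤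
        ∑ k, (ENNReal.ofReal (4 / ε ^ 2 * (mean (M.hyp j) (fk k (s, z)) - b (fk k (s, z))) ^ 2) +
          g k z) := by
      by_cases hz : respond b A s z ∈ B
      · obtain ⟨k, hk⟩ := hz
        refine le_trans ?_ (Finset.single_le_sum (fun _ _ => zero_le) (Finset.mem_univ k))
        refine (Set.indicator_le_self' (fun _ _ => zero_le) _).trans ?_
        rw [respond_apply] at hk
        by_cases hzk : ε / 2 ≤ |z k|
        · refine le_add_left ?_
          simp [hg, hzk]
        · refine le_add_right ?_
          rw [Pi.one_apply, ← ENNReal.ofReal_one]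
          refine ENNReal.ofReal_le_ofReal ?_
          have h1 : ε / 2 ≤ |mean (M.hyp j) (fk k (s, z)) - b (fk k (s, z))| := by
            rw [← sub_sub] at hk
            have := abs_sub (mean (M.hyp j) (fk k (s, z)) - b (fk k (s, z))) (z k)
            have h2 : ε ≤ |mean (M.hyp j) (fk k (s, z)) - b (fk k (s, z)) - z k| := hk
            linarith
          rw [div_mul_eq_mul_div, le_div_iff₀ (by positivity), ← sq_abs (_ - _)]
          nlinarith
      · rw [Set.indicator_of_notMem hz]
        exact zero_le
    calc B.indicator 1 (respond b A s z) +
          ∑ k, swapCost v (M.posteriorMean x) b (A.asked s (respond b A s z) k)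
        ≤ _ := add_le_add hind (Finset.sum_le_sum fun k _ => hcost k)
      _ = H j x (s, z) := by
        rw [← Finset.sum_add_distrib]
        refine Finset.sum_congr rfl fun k _ => ?_
        have hadd : ENNReal.ofReal (h j x (fk k (s, z))) =
            ENNReal.ofReal (4 / ε ^ 2 * (mean (M.hyp j) (fk k (s, z)) - b (fk k (s, z))) ^ 2) +
            ENNReal.ofReal (θ + κ * (M.posteriorMean x (fk k (s, z)) - b (fk k (s, z))) ^ 2) :=
          ENNReal.ofReal_add (by positivity) (by positivity)
        rw [hadd, add_right_comm]
  refine (Finset.sum_le_sum fun j _ => Finset.sum_le_sum fun x _ =>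
    mul_le_mul_right (hbound j x) _).trans ?_
  have hVn : 0 ≤ V := (Finset.sum_nonneg fun j _ => mul_nonneg ENNReal.toReal_nonneg
    (sq_nonneg _)).trans (hV fun _ => 0)
  have hsumh : ∀ f, ∑ j, ∑ x, M.jointWeight x j * h j x f ≤ 4 / ε ^ 2 * V + θ + κ * V := by
    intro f
    have h1 := M.posteriorMean_sq_error_add (n := n) f (b f)
    have h2 : 0 ≤ ∑ j, ∑ x : Fin n → X,
        M.jointWeight x j * (mean (M.hyp j) f - M.posteriorMean x f) ^ 2 :=
      Finset.sum_nonneg fun j _ => Finset.sum_nonneg fun x _ =>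
        mul_nonneg (M.jointWeight_nonneg x j) (sq_nonneg _)
    have h3 : ∑ j, ∑ x, M.jointWeight x j * h j x f =
        4 / ε ^ 2 * ∑ j, (M.prior j).toReal * (mean (M.hyp j) f - b f) ^ 2 + θ +
          κ * ∑ j, ∑ x : Fin n → X, M.jointWeight x j * (M.posteriorMean x f - b f) ^ 2 := by
      conv_rhs => rw [← mul_one θ, ← M.sum_sum_jointWeight (n := n)]
      simp_rw [← M.sum_jointWeight (n := n), Finset.sum_mul, Finset.mul_sum,
        ← Finset.sum_add_distrib]
      refine Finset.sum_congr rfl fun j _ => Finset.sum_congr rfl fun x _ => ?_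
      rw [hh]
      ring
    rw [h3]
    gcongr
    · exact hV f
    · linarith [hV f]
  have hpoint : ∀ p, ∑ j, ∑ x, ENNReal.ofReal (M.jointWeight x j) * H j x p ≤
      ∑ k, (ENNReal.ofReal (4 / ε ^ 2 * V + θ + κ * V) + g k p.2) := by
    intro p
    have : ∑ j, ∑ x, ENNReal.ofReal (M.jointWeight x j) * H j x p =
        ∑ k, (∑ j, ∑ x, ENNReal.ofReal (M.jointWeight x j) * ENNReal.ofReal (h j x (fk k p)) +
          (∑ j, ∑ x : Fin n → X, ENNReal.ofReal (M.jointWeight x j)) * g k p.2) := by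
      simp_rw [hH, Finset.sum_mul, ← Finset.sum_add_distrib, Finset.mul_sum, ← mul_add]
      conv_rhs => rw [Finset.sum_comm]
      exact Finset.sum_congr rfl fun j _ => Finset.sum_comm
    rw [this]
    refine Finset.sum_le_sum fun k _ => ?_
    rw [M.sum_ofReal_jointWeight, one_mul, M.sum_ofReal_jointWeight_mul_ofReal
      fun j x => hh0 j x _]
    gcongr
    exact hsumh _
  calc ∑ j, ∑ x, ENNReal.ofReal (M.jointWeight x j) * ∫⁻ p, H j x p ∂(ρ.prod γ)
      = ∫⁻ p, ∑ j, ∑ x, ENNReal.ofReal (M.jointWeight x j) * H j x p ∂(ρ.prod γ) := by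
        rw [lintegral_finsetSum _ fun j _ => Finset.measurable_sum _ fun x _ =>
          (hHm j x).const_mul _]
        refine Finset.sum_congr rfl fun j _ => ?_
        rw [lintegral_finsetSum _ fun x _ => (hHm j x).const_mul _]
        exact Finset.sum_congr rfl fun x _ => (lintegral_const_mul _ (hHm j x)).symm
    _ ≤ ∫⁻ p, ∑ k, (ENNReal.ofReal (4 / ε ^ 2 * V + θ + κ * V) + g k p.2) ∂(ρ.prod γ) :=
        lintegral_mono hpoint
    _ = ∑ k : Fin q, (ENNReal.ofReal (4 / ε ^ 2 * V + θ + κ * V) +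
          γ {z | ε / 2 ≤ |z k|}) := by
        have hgm' : ∀ k, Measurable fun p : S × (Fin q → ℝ) => g k p.2 := fun k =>
          (measurable_one.indicator (hgm k)).comp measurable_snd
        rw [lintegral_finsetSum _ fun k _ => (hgm' k).const_add _]
        refine Finset.sum_congr rfl fun k _ => ?_
        rw [lintegral_add_left measurable_const, lintegral_const, measure_univ, mul_one,
          lintegral_prod _ (hgm' k).aemeasurable]
        simp [hg, lintegral_indicator_one (hgm k)]
    _ ≤ ∑ k : Fin q, ENNReal.ofReal (4 / ε ^ 2 * V + θ + κ * V +
          2 * Real.exp (-(n * ε ^ 2 / 2))) := by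
        refine Finset.sum_le_sum fun k _ => ?_
        rw [ENNReal.ofReal_add (p := 4 / ε ^ 2 * V + θ + κ * V) (by positivity) (by positivity)]
        refine add_le_add le_rfl ?_
        refine (pi_noise_le k (by positivity)).trans (ENNReal.ofReal_le_ofReal (le_of_eq ?_))
        congr 3
        ring
    _ = _ := by
        rw [Finset.sum_const, Finset.card_univ, Fintype.card_fin, nsmul_eq_mul,
          ENNReal.ofReal_mul (Nat.cast_nonneg q), ENNReal.ofReal_natCast, hκn]

/-- Anti-concentration for a single query: the answer is accurate with probability proportional
to the accuracy. -/
lemma le_gameLaw_allAccurate_one (hn : n ≠ 0)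
    (hV : ∀ f, ∑ j, ∑ x : Fin n → X,
      M.jointWeight x j * (mean (M.hyp j) f - M.posteriorMean x f) ^ 2 ≤ 2 / n)
    {ε : ℝ} (hε : 0 ≤ ε) :
    ENNReal.ofReal (ε * √n * Real.exp (-(4 * n * ε ^ 2 + 8))) ≤
      gameLaw M ρ n 1 (allAccurate M A n 1 ε) := by
  rw [gameLaw_apply M ρ fun j x => measurableSet_allAccurate_section M A ε j x]
  have hn' : (0 : ℝ) < n := by positivity
  set v := noiseVariance n with hv
  have hv0 : v ≠ 0 := noiseVariance_ne_zero hn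
  have hvr : (v : ℝ) = 1 / (4 * n) := coe_noiseVariance n
  have hvpos : (0 : ℝ) < v := by positivity
  set fq : S → X → unitInterval := fun s => A.query 0 s Fin.elim0 with hfq
  have hfqm : Measurable fq := measurable_pi_iff.2 fun x =>
    (A.measurable_query 0 x).comp (measurable_id.prodMk measurable_const)
  set D : J → (Fin n → X) → S → ℝ := fun j x s =>
    mean (M.hyp j) (fq s) - M.posteriorMean x (fq s) with hD
  have hDm : ∀ j x, Measurable (D j x) := fun j x =>
    ((measurable_mean _).comp hfqm).sub ((M.measurable_posteriorMean x).comp hfqm)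
  set c : ℝ := ε * √n * Real.exp (-(4 * n * ε ^ 2)) with hc
  have hc0 : 0 ≤ c := by positivity
  set h : J → (Fin n → X) → S → ℝ := fun j x s => c * Real.exp (-(4 * n * D j x s ^ 2)) with hh
  have hh0 : ∀ j x s, 0 ≤ h j x s := fun j x s => by positivity
  have hhm : ∀ j x, Measurable (h j x) := fun j x =>
    (Real.measurable_exp.comp (((hDm j x).pow_const 2).const_mul _).neg).const_mul _
  have hbound : ∀ j, ∀ x : Fin n → X, ∀ s, ENNReal.ofReal (h j x s) ≤
      (Measure.pi fun _ : Fin 1 => gaussianReal 0 v)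
        {z | (j, x, s, z) ∈ allAccurate M A n 1 ε} := by
    intro j x s
    have hset : {z | (j, x, s, z) ∈ allAccurate M A n 1 ε} =
        {z : Fin 1 → ℝ | z 0 ∈ {t | |t - D j x s| < ε}} := by
      ext z
      have hq : A.asked s (noisyAnswers M A s x z) 0 = fq s := by
        unfold Analyst.asked
        exact congrArg _ (funext fun i => i.elim0)
      simp only [allAccurate, Set.mem_ofPred_eq, Fin.forall_fin_one]
      rw [noisyAnswers_apply, hq, ← abs_neg, hD]
      ring_nf
    rw [hset, pi_eval_preimage _ _ (measurableSet_lt (by fun_prop) measurable_const)]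
    refine (ENNReal.ofReal_le_ofReal ?_).trans (le_gaussianReal_ball hv0 (D j x s) ε)
    have hsqrt : √(n : ℝ) ≤ 2 * (√(2 * Real.pi * v))⁻¹ := by
      have h1 : √(2 * Real.pi * v) * √n ≤ 2 := by
        rw [← Real.sqrt_mul (by positivity), hvr]
        refine Real.sqrt_le_iff.2 ⟨by norm_num, ?_⟩
        have : 2 * Real.pi * (1 / (4 * n)) * n = Real.pi / 2 := by field_simp; ring
        rw [this]
        linarith [Real.pi_le_four]
      have h2 : 0 < √(2 * Real.pi * v) := by positivity
      rw [← div_eq_mul_inv, le_div_iff₀ h2]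
      linarith
    have hexp : -(D j x s ^ 2 + ε ^ 2) / v = -(4 * n * ε ^ 2) + -(4 * n * D j x s ^ 2) := by
      rw [hvr]; field_simp; ring
    rw [hexp, Real.exp_add, hh, hc]
    calc ε * √n * Real.exp (-(4 * n * ε ^ 2)) * Real.exp (-(4 * n * D j x s ^ 2))
        ≤ ε * (2 * (√(2 * Real.pi * v))⁻¹) * Real.exp (-(4 * n * ε ^ 2)) *
          Real.exp (-(4 * n * D j x s ^ 2)) := by gcongr
      _ = _ := by ring
  have hpoint : ∀ s, c * Real.exp (-8) ≤ ∑ j, ∑ x, M.jointWeight x j * h j x s := by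
    intro s
    -- Jensen by the tangent `exp (8 - y) ≥ 9 - y` with `y = 4nD²`, whose average is at most `8` by
    -- `hV`.
    have htan : ∀ j x, c * Real.exp (-8) * (9 - 4 * n * D j x s ^ 2) ≤ h j x s := by
      intro j x
      have h1 := Real.add_one_le_exp (8 - 4 * n * D j x s ^ 2)
      have h2 : Real.exp (-(4 * n * D j x s ^ 2)) =
          Real.exp (-8) * Real.exp (8 - 4 * n * D j x s ^ 2) := by
        rw [← Real.exp_add]; ring_nf
      rw [hh]
      dsimp only
      rw [h2, mul_assoc]
      gcongr
      linarith
    have hsum : ∑ j, ∑ x, M.jointWeight x j * (c * Real.exp (-8) * (9 - 4 * n * D j x s ^ 2)) =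
        c * Real.exp (-8) * (9 - 4 * n * ∑ j, ∑ x, M.jointWeight x j * D j x s ^ 2) := by
      conv_rhs => rw [← mul_one (9 : ℝ), ← M.sum_sum_jointWeight (n := n)]
      simp_rw [Finset.mul_sum, ← Finset.sum_sub_distrib, Finset.mul_sum]
      exact Finset.sum_congr rfl fun j _ => Finset.sum_congr rfl fun x _ => by ring
    refine le_trans ?_ (Finset.sum_le_sum fun j _ => Finset.sum_le_sum fun x _ =>
      mul_le_mul_of_nonneg_left (htan j x) (M.jointWeight_nonneg x j))
    rw [hsum]
    refine le_mul_of_one_le_right (by positivity) ?_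
    have h4 := mul_le_mul_of_nonneg_left (hV (fq s)) (show (0 : ℝ) ≤ 4 * n by positivity)
    have h5 : (4 : ℝ) * n * (2 / n) = 8 := by field_simp; norm_num
    rw [h5] at h4
    linarith
  calc ENNReal.ofReal (ε * √n * Real.exp (-(4 * n * ε ^ 2 + 8)))
      = ∫⁻ _, ENNReal.ofReal (c * Real.exp (-8)) ∂ρ := by
        rw [lintegral_const, measure_univ, mul_one, hc, mul_assoc _ (Real.exp _) (Real.exp _),
          ← Real.exp_add]
        congr 3
        ring
    _ ≤ ∫⁻ s, ∑ j, ∑ x, ENNReal.ofReal (M.jointWeight x j) * ENNReal.ofReal (h j x s) ∂ρ := by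
        refine lintegral_mono fun s => ?_
        dsimp only
        rw [M.sum_ofReal_jointWeight_mul_ofReal fun j x => hh0 j x s]
        exact ENNReal.ofReal_le_ofReal (hpoint s)
    _ = ∑ j, ∑ x, ENNReal.ofReal (M.jointWeight x j) * ∫⁻ s, ENNReal.ofReal (h j x s) ∂ρ := by
        rw [lintegral_finsetSum _ fun j _ => Finset.measurable_sum _ fun x _ =>
          (hhm j x).ennreal_ofReal.const_mul _]
        refine Finset.sum_congr rfl fun j _ => ?_
        rw [lintegral_finsetSum _ fun x _ => (hhm j x).ennreal_ofReal.const_mul _]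
        exact Finset.sum_congr rfl fun x _ => lintegral_const_mul _ (hhm j x).ennreal_ofReal
    _ ≤ _ := Finset.sum_le_sum fun j _ => Finset.sum_le_sum fun x _ =>
        mul_le_mul_right (lintegral_mono fun s => hbound j x s) _

end Bounds

/-! ### Characters and affine functions over `𝔽₂`. -/

section Linear

variable {m : ℕ}

/-- The affine function with coefficients `c`. -/
def affineEval (c : ZMod 2 × (Fin m → ZMod 2)) (y : Fin m → ZMod 2) : ZMod 2 :=
  c.1 + ∑ k, c.2 k * y k

/-- The sign character of `ZMod 2`. -/
def signChar (t : ZMod 2) : ℝ := if t = 0 then 1 else -1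

lemma signChar_add (s t : ZMod 2) : signChar (s + t) = signChar s * signChar t := by
  have h : (1 : ZMod 2) + 1 = 0 := by decide
  have h01 : ∀ t : ZMod 2, t = 0 ∨ t = 1 := by decide
  rcases h01 s with rfl | rfl <;> rcases h01 t with rfl | rfl <;> simp [signChar, h]

lemma signChar_mul_of_ne {s t : ZMod 2} (h : s ≠ t) : signChar s * signChar t = -1 := by
  have : s + t ≠ 0 := by revert h; revert s t; decide
  rw [← signChar_add, signChar, if_neg this]

lemma signChar_mul_self (s : ZMod 2) : signChar s * signChar s = 1 := by
  unfold signChar; split_ifs <;> norm_num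

lemma affineEval_add_single_left (c : ZMod 2 × (Fin m → ZMod 2)) (y : Fin m → ZMod 2)
    (k : Fin m) : affineEval (c + (0, Pi.single k 1)) y = affineEval c y + y k := by
  simp [affineEval, add_mul, Finset.sum_add_distrib, Pi.single_apply, add_assoc]

lemma affineEval_add_single_right (c : ZMod 2 × (Fin m → ZMod 2)) (y : Fin m → ZMod 2)
    (k : Fin m) : affineEval c (y + Pi.single k 1) = affineEval c y + c.2 k := by
  simp [affineEval, mul_add, Finset.sum_add_distrib, Pi.single_apply, add_assoc]

/-- Translation by `e` permutes `G`, so the sum equals its own negative. -/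
lemma sum_eq_zero_of_add_eq_neg {G : Type*} [AddGroup G] [Fintype G] {g : G → ℝ} (e : G)
    (h : ∀ a, g (a + e) = -g a) : ∑ a, g a = 0 := by
  have h1 := Equiv.sum_comp (Equiv.addRight e) g
  simp only [Equiv.coe_addRight, h, Finset.sum_neg_distrib] at h1
  linarith

/-- Flipping a coefficient at which `y` and `y'` differ changes the sign of the product. -/
lemma sum_signChar_affineEval_coeff {y y' : Fin m → ZMod 2} (h : y ≠ y') :
    ∑ c, signChar (affineEval c y) * signChar (affineEval c y') = 0 := by
  obtain ⟨k, hk⟩ := Function.ne_iff.1 h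
  refine sum_eq_zero_of_add_eq_neg (0, Pi.single k 1) fun c => ?_
  rw [affineEval_add_single_left, affineEval_add_single_left, signChar_add, signChar_add,
    mul_mul_mul_comm, signChar_mul_of_ne hk, mul_neg_one]

/-- The sum vanishes if the linear parts differ. If only the constants differ, every product is
`-1`; hence an inequality. -/
lemma sum_signChar_affineEval_point_nonpos {c c' : ZMod 2 × (Fin m → ZMod 2)} (h : c ≠ c') :
    ∑ y, signChar (affineEval c y) * signChar (affineEval c' y) ≤ 0 := by
  by_cases h2 : c.2 = c'.2
  · have h1 : c.1 ≠ c'.1 := fun h1 => h (Prod.ext h1 h2)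
    refine Finset.sum_nonpos fun y _ => ?_
    rw [signChar_mul_of_ne]
    · norm_num
    · simpa [affineEval, h2] using h1
  · obtain ⟨k, hk⟩ := Function.ne_iff.1 h2
    refine (sum_eq_zero_of_add_eq_neg (Pi.single k 1) fun y => ?_).le
    rw [affineEval_add_single_right, affineEval_add_single_right, signChar_add, signChar_add,
      mul_mul_mul_comm, signChar_mul_of_ne hk, mul_neg_one]

lemma card_points (m : ℕ) : Fintype.card (Fin m → ZMod 2) = 2 ^ m := by
  simp [ZMod.card]

lemma card_coeffs (m : ℕ) : Fintype.card (ZMod 2 × (Fin m → ZMod 2)) = 2 * 2 ^ m := by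
  simp [ZMod.card]

lemma linearClassification_prior_toReal (c : ZMod 2 × (Fin m → ZMod 2)) :
    ((linearClassification m).prior c).toReal = (2 * 2 ^ m)⁻¹ := by
  simp only [linearClassification, PMF.uniformOfFintype_apply, card_coeffs]
  simp

lemma linearClassification_hyp_toReal (c : ZMod 2 × (Fin m → ZMod 2)) (y : Fin m → ZMod 2)
    (t : ZMod 2) : ((linearClassification m).hyp c (y, t)).toReal =
      if t = affineEval c y then (2 ^ m : ℝ)⁻¹ else 0 := by
  simp only [linearClassification, PMF.map_apply, PMF.uniformOfFintype_apply, card_points,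
    Prod.mk.injEq]
  rw [tsum_eq_single y fun y' hy' => if_neg fun h => hy' h.1.symm]
  simp only [true_and, affineEval]
  by_cases h : t = c.1 + ∑ k, c.2 k * y k <;> simp [h]

lemma linearClassification_sum_hyp (c : ZMod 2 × (Fin m → ZMod 2))
    (g : (Fin m → ZMod 2) × ZMod 2 → ℝ) :
    ∑ x, ((linearClassification m).hyp c x).toReal * g x =
      (2 ^ m : ℝ)⁻¹ * ∑ y, g (y, affineEval c y) := by
  rw [Fintype.sum_prod_type, Finset.mul_sum]
  refine Finset.sum_congr rfl fun y _ => ?_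
  simp [linearClassification_hyp_toReal, ite_mul]

/-- The prior mean of a query: both labels are equally likely at every point. -/
noncomputable def labelAverage (f : (Fin m → ZMod 2) × ZMod 2 → unitInterval) : ℝ :=
  (2 ^ m : ℝ)⁻¹ * ∑ y, ((f (y, 0) : ℝ) + f (y, 1)) / 2

lemma measurable_labelAverage : Measurable (labelAverage (m := m)) := by
  unfold labelAverage
  refine (Finset.measurable_sum _ fun y _ => ?_).const_mul _
  exact ((measurable_subtype_coe.comp (measurable_pi_apply _)).add
    (measurable_subtype_coe.comp (measurable_pi_apply _))).div_const _

/-- At each point the query is its half-sum plus its half-difference times the sign of the label. -/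
lemma mean_sub_labelAverage (c : ZMod 2 × (Fin m → ZMod 2))
    (f : (Fin m → ZMod 2) × ZMod 2 → unitInterval) :
    mean ((linearClassification m).hyp c) f - labelAverage f =
      (2 ^ m : ℝ)⁻¹ * ∑ y, ((f (y, 0) : ℝ) - f (y, 1)) / 2 * signChar (affineEval c y) := by
  rw [mean, linearClassification_sum_hyp c fun x => (f x : ℝ), labelAverage, ← mul_sub,
    ← Finset.sum_sub_distrib]
  congr 1
  refine Finset.sum_congr rfl fun y _ => ?_
  generalize affineEval c y = t
  have h : t = 0 ∨ t = 1 := by revert t; decide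
  rcases h with rfl | rfl <;> simp [signChar] <;> ring

/-- Expanding the square, orthogonality over the coefficients kills all off-diagonal terms, and each
half-difference is at most `1/2` in absolute value. -/
lemma linearClassification_variance_le (f : (Fin m → ZMod 2) × ZMod 2 → unitInterval) :
    ∑ c, ((linearClassification m).prior c).toReal *
      (mean ((linearClassification m).hyp c) f - labelAverage f) ^ 2 ≤ (2 ^ m : ℝ)⁻¹ / 4 := by
  classical
  set h : (Fin m → ZMod 2) → ℝ := fun y => ((f (y, 0) : ℝ) - f (y, 1)) / 2 with hh
  have hsq : ∀ y, h y ^ 2 ≤ 1 / 4 := by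
    intro y
    have h0 := (f (y, 0)).2
    have h1 := (f (y, 1)).2
    have : |h y| ≤ 1 / 2 := by
      rw [abs_le]
      constructor <;> simp only [hh] <;> linarith [h0.1, h0.2, h1.1, h1.2]
    rw [← sq_abs]
    nlinarith [abs_nonneg (h y)]
  have hcard : ∑ _c : ZMod 2 × (Fin m → ZMod 2), (1 : ℝ) = 2 * 2 ^ m := by
    rw [Finset.sum_const, Finset.card_univ, card_coeffs]; simp
  have hmain : ∑ c, (∑ y, h y * signChar (affineEval c y)) ^ 2 = 2 * 2 ^ m * ∑ y, h y ^ 2 := by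
    calc ∑ c, (∑ y, h y * signChar (affineEval c y)) ^ 2
        = ∑ y, ∑ y', h y * h y' *
            ∑ c, signChar (affineEval c y) * signChar (affineEval c y') := by
          simp_rw [sq, Finset.sum_mul_sum, Finset.mul_sum]
          rw [Finset.sum_comm]
          refine Finset.sum_congr rfl fun y _ => ?_
          rw [Finset.sum_comm]
          exact Finset.sum_congr rfl fun y' _ => Finset.sum_congr rfl fun c _ => by ring
      _ = ∑ y, h y * h y * (2 * 2 ^ m) := by
          refine Finset.sum_congr rfl fun y _ => ?_
          rw [Finset.sum_eq_single y]
          · simp_rw [signChar_mul_self, hcard]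
          · intro y' _ hy'
            rw [sum_signChar_affineEval_coeff hy'.symm, mul_zero]
          · simp
      _ = _ := by rw [← Finset.sum_mul, mul_comm]; simp_rw [sq]
  have hN : (0 : ℝ) < 2 ^ m := by positivity
  simp_rw [linearClassification_prior_toReal, mean_sub_labelAverage, mul_pow]
  rw [← Finset.mul_sum, ← Finset.mul_sum, hmain]
  have hle : ∑ y, h y ^ 2 ≤ 2 ^ m * (1 / 4) := by
    refine (Finset.sum_le_sum fun y _ => hsq y).trans (le_of_eq ?_)
    rw [Finset.sum_const, Finset.card_univ, card_points]; simp
  calc (2 * 2 ^ m : ℝ)⁻¹ * ((2 ^ m : ℝ)⁻¹ ^ 2 * (2 * 2 ^ m * ∑ y, h y ^ 2))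
      = (2 ^ m : ℝ)⁻¹ ^ 2 * ∑ y, h y ^ 2 := by field_simp
    _ ≤ (2 ^ m : ℝ)⁻¹ ^ 2 * (2 ^ m * (1 / 4)) := by gcongr
    _ = _ := by field_simp

/-- Two distinct affine functions agree on at most half of the points. -/
lemma sum_hyp_agree_le {c c' : ZMod 2 × (Fin m → ZMod 2)} (h : c ≠ c') :
    ∑ x, ((linearClassification m).hyp c x).toReal *
      (if x.2 = affineEval c' x.1 then (1 : ℝ) else 0) ≤ 1 / 2 := by
  rw [linearClassification_sum_hyp c fun x => if x.2 = affineEval c' x.1 then (1 : ℝ) else 0]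
  have hind : ∀ y, (if affineEval c y = affineEval c' y then (1 : ℝ) else 0) =
      1 / 2 + signChar (affineEval c y) * signChar (affineEval c' y) / 2 := by
    intro y
    split_ifs with hy
    · rw [hy, signChar_mul_self]; norm_num
    · rw [signChar_mul_of_ne hy]; norm_num
  simp_rw [hind, Finset.sum_add_distrib, ← Finset.sum_div]
  have h1 := sum_signChar_affineEval_point_nonpos h
  rw [Finset.sum_const, Finset.card_univ, card_points, inv_mul_le_iff₀ (by positivity)]
  simp only [nsmul_eq_mul, Nat.cast_pow, Nat.cast_ofNat]
  linarith

/-- If no rival fits all samples, the posterior is a point mass at the truth; otherwise some rival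
agrees with `n` independent samples, each with probability at most `1/2`. -/
lemma linearClassification_undeterminedProb_le (m n : ℕ) :
    (linearClassification m).undeterminedProb n ≤ 2 * 2 ^ m * (1 / 2) ^ n := by
  classical
  set M := linearClassification m with hM
  set agree : (ZMod 2 × (Fin m → ZMod 2)) → (Fin m → ZMod 2) × ZMod 2 → ℝ :=
    fun c' x => if x.2 = affineEval c' x.1 then 1 else 0 with hagree
  have hag0 : ∀ c' x, 0 ≤ agree c' x := fun c' x => by
    simp only [hagree]; split_ifs <;> norm_num
  have hpoint : ∀ c, ∀ x : Fin n → _, M.jointWeight x c *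
      (if ∃ f, M.posteriorMean x f ≠ mean (M.hyp c) f then 1 else 0) ≤
      ∑ c' ∈ Finset.univ.erase c, M.jointWeight x c * ∏ i, agree c' (x i) := by
    intro c x
    have hnn : ∀ c' ∈ Finset.univ.erase c, 0 ≤ M.jointWeight x c * ∏ i, agree c' (x i) :=
      fun c' _ => mul_nonneg (M.jointWeight_nonneg x c) (Finset.prod_nonneg fun i _ => hag0 _ _)
    split_ifs with hex
    · by_cases hex' : ∃ c' ∈ Finset.univ.erase c, ∀ i, (x i).2 = affineEval c' (x i).1
      · obtain ⟨c', hc', hall⟩ := hex'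
        refine le_trans (le_of_eq ?_) (Finset.single_le_sum hnn hc')
        simp [hagree, hall]
      · have hzero : ∀ c', c' ≠ c → M.jointWeight x c' = 0 := by
          intro c' hc'
          push Not at hex'
          obtain ⟨i, hi⟩ := hex' c' (Finset.mem_erase.2 ⟨hc', Finset.mem_univ _⟩)
          refine mul_eq_zero_of_right _ (Finset.prod_eq_zero (Finset.mem_univ i) ?_)
          have := linearClassification_hyp_toReal c' (x i).1 (x i).2
          rwa [if_neg hi] at this
        by_cases hc : M.jointWeight x c = 0
        · rw [hc, zero_mul]
          exact le_of_eq (Finset.sum_eq_zero fun c' _ => zero_mul _).symm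
        · exfalso
          obtain ⟨f, hf⟩ := hex
          apply hf
          have hsum : ∑ c', M.jointWeight x c' = M.jointWeight x c :=
            Finset.sum_eq_single c (fun c' _ h => hzero c' h) (by simp)
          rw [Model.posteriorMean, Finset.sum_eq_single c]
          · rw [Model.posteriorWeight, hsum, div_self hc, one_mul]
          · intro c' _ h
            rw [Model.posteriorWeight, hzero c' h, zero_div, zero_mul]
          · simp
    · rw [mul_zero]
      exact Finset.sum_nonneg hnn
  have hpair : ∀ c, ∀ c' ∈ Finset.univ.erase c,
      ∑ x : Fin n → _, M.jointWeight x c * ∏ i, agree c' (x i) ≤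
        (M.prior c).toReal * (1 / 2) ^ n := by
    intro c c' hc'
    simp_rw [Model.jointWeight, mul_assoc, ← Finset.prod_mul_distrib]
    rw [← Finset.mul_sum,
      ← Fintype.prod_sum fun (_ : Fin n) x => (M.hyp c x).toReal * agree c' x, Finset.prod_const,
      Finset.card_univ, Fintype.card_fin]
    gcongr
    exact sum_hyp_agree_le (Finset.ne_of_mem_erase hc').symm
  calc M.undeterminedProb n
      ≤ ∑ c, ∑ x : Fin n → _, ∑ c' ∈ Finset.univ.erase c,
          M.jointWeight x c * ∏ i, agree c' (x i) :=
        Finset.sum_le_sum fun c _ => Finset.sum_le_sum fun x _ => hpoint c x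
    _ = ∑ c, ∑ c' ∈ Finset.univ.erase c, ∑ x : Fin n → _,
          M.jointWeight x c * ∏ i, agree c' (x i) :=
        Finset.sum_congr rfl fun c _ => Finset.sum_comm
    _ ≤ ∑ c, ∑ c' ∈ Finset.univ.erase c, (M.prior c).toReal * (1 / 2) ^ n :=
        Finset.sum_le_sum fun c _ => Finset.sum_le_sum fun c' hc' => hpair c c' hc'
    _ ≤ ∑ c, ∑ _c' : ZMod 2 × (Fin m → ZMod 2), (M.prior c).toReal * (1 / 2) ^ n :=
        Finset.sum_le_sum fun c _ => Finset.sum_le_sum_of_subset_of_nonneg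
          (Finset.erase_subset _ _) fun _ _ _ => by positivity
    _ = _ := by
        simp_rw [Finset.sum_const, Finset.card_univ, card_coeffs, ← Finset.smul_sum,
          ← Finset.sum_mul, sum_toReal_eq_one]
        simp

end Linear

/-! ### The two regimes `n > 2m` and `n ≤ 2m`. -/

section LinearBounds

variable {S : Type*} [MeasurableSpace S] (ρ : Measure S) [IsProbabilityMeasure ρ] {m n q : ℕ}
  (A : Analyst ((Fin m → ZMod 2) × ZMod 2) S)

lemma half_pow_le_exp (k : ℕ) : (1 / 2 : ℝ) ^ k ≤ Real.exp (-(k / 2)) := by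
  have h : (1 / 2 : ℝ) ≤ Real.exp (-(1 / 2)) := by
    have := Real.add_one_le_exp (-(1 / 2) : ℝ)
    linarith
  calc (1 / 2 : ℝ) ^ k ≤ Real.exp (-(1 / 2)) ^ k := by gcongr
    _ = _ := by rw [← Real.exp_nat_mul]; ring_nf

lemma two_mul_two_pow_mul_half_pow {m n : ℕ} (h : m ≤ n) :
    2 * (2 : ℝ) ^ m * (1 / 2) ^ n = 2 * (1 / 2) ^ (n - m) := by
  obtain ⟨k, rfl⟩ := Nat.exists_eq_add_of_le h
  rw [pow_add, Nat.add_sub_cancel_left, mul_assoc, ← mul_assoc ((2 : ℝ) ^ m), ← mul_pow]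
  norm_num

lemma linearClassification_sq_error_le (hn : n ≠ 0)
    (f : (Fin m → ZMod 2) × ZMod 2 → unitInterval) :
    ∑ c, ∑ x : Fin n → _, (linearClassification m).jointWeight x c *
      (mean ((linearClassification m).hyp c) f - (linearClassification m).posteriorMean x f) ^ 2 ≤
      2 / n := by
  have hn' : (0 : ℝ) < n := by positivity
  rcases lt_or_ge (2 * m) n with h | h
  · refine ((linearClassification m).sum_sq_error_le_undeterminedProb f).trans
      ((linearClassification_undeterminedProb_le m n).trans ?_)
    rw [two_mul_two_pow_mul_half_pow (by omega), one_div, inv_pow, ← div_eq_mul_inv]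
    gcongr
    -- From `2m < n` follows `n ≤ 2(k + 1) ≤ 2^(k + 1)`.
    obtain ⟨k, hk⟩ : ∃ k, n - m = k + 1 := ⟨n - m - 1, by omega⟩
    rw [hk]
    have h1 : k < 2 ^ k := Nat.lt_two_pow_self
    have h2 : n ≤ 2 ^ (k + 1) := by rw [pow_succ]; omega
    exact_mod_cast h2
  · have h1 := (linearClassification m).posteriorMean_sq_error_add (n := n) f (labelAverage f)
    have h2 := linearClassification_variance_le f
    have h3 : 0 ≤ ∑ c, ∑ x : Fin n → _, (linearClassification m).jointWeight x c *
        ((linearClassification m).posteriorMean x f - labelAverage f) ^ 2 :=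
      Finset.sum_nonneg fun c _ => Finset.sum_nonneg fun x _ =>
        mul_nonneg ((linearClassification m).jointWeight_nonneg x c) (sq_nonneg _)
    have h4 : (n : ℝ) ≤ 2 * 2 ^ m := by
      have h5 : m < 2 ^ m := Nat.lt_two_pow_self
      have h6 : n ≤ 2 * 2 ^ m := by omega
      exact_mod_cast h6
    have h7 : (2 ^ m : ℝ)⁻¹ / 4 ≤ 2 / n := by
      rw [inv_eq_one_div, div_div, div_le_div_iff₀ (by positivity) hn']
      linarith [show (0 : ℝ) < 2 ^ m by positivity]
    linarith

/-- Failure probability of the noisy posterior mean curator for linear classification. -/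
lemma gameLaw_compl_allAccurate_le (hn : n ≠ 0) (hq : 1 ≤ q) {ε : ℝ} (hε : 0 < ε) (hε1 : ε < 1) :
    gameLaw (linearClassification m) ρ n q (allAccurate (linearClassification m) A n q ε)ᶜ ≤
      ENNReal.ofReal (32 * q * Real.exp (-(n * ε ^ 2 / 16))) := by
  have hn' : (0 : ℝ) < n := by positivity
  have hq' : (1 : ℝ) ≤ q := by exact_mod_cast hq
  have hε2 : ε ^ 2 ≤ 1 := by nlinarith
  set w := Real.exp (-(n * ε ^ 2 / 16)) with hw
  have hw0 : 0 < w := Real.exp_pos _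
  rcases lt_or_ge (2 * m) n with h | h
  · refine (gameLaw_compl_allAccurate_le_of_undeterminedProb _ ρ A hε.le).trans
      (ENNReal.ofReal_le_ofReal ?_)
    have h1 : (linearClassification m).undeterminedProb n ≤ 2 * w := by
      refine (linearClassification_undeterminedProb_le m n).trans ?_
      rw [two_mul_two_pow_mul_half_pow (by omega)]
      gcongr
      refine (half_pow_le_exp _).trans (Real.exp_le_exp.2 ?_)
      have h2 : (n : ℝ) ≤ 2 * ((n - m : ℕ) : ℝ) := by
        have : n ≤ 2 * (n - m) := by omega
        exact_mod_cast this
      nlinarith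
    have h3 : Real.exp (-(2 * n * ε ^ 2)) ≤ w :=
      Real.exp_le_exp.2 (by nlinarith [mul_nonneg hn'.le (sq_nonneg ε)])
    calc (linearClassification m).undeterminedProb n + q * (2 * Real.exp (-(2 * n * ε ^ 2)))
        ≤ 2 * w + q * (2 * w) := by gcongr
      _ ≤ 32 * q * w := by nlinarith [mul_le_mul_of_nonneg_right hq' hw0.le]
  -- If `nε² < 1` the claimed bound exceeds `1`; otherwise `4 / ε² ≤ 4n` controls the Chebyshev
  -- factor.
  rcases lt_or_ge (n * ε ^ 2) 1 with hsmall | hlarge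
  · have := isProbabilityMeasure_gameLaw (linearClassification m) ρ (n := n) (q := q)
    refine prob_le_one.trans ?_
    rw [← ENNReal.ofReal_one]
    refine ENNReal.ofReal_le_ofReal ?_
    have h1 : 1 / 2 ≤ w := by
      have := Real.add_one_le_exp (-(n * ε ^ 2 / 16))
      linarith
    nlinarith
  -- With `θ = t = exp (-n/16)` the prior variance is at most `t⁴ / 4`. This pays for the factors
  -- `n` and `n / t`, since `n t ≤ 16`.
  · refine (gameLaw_compl_allAccurate_le_of_variance _ ρ A hn measurable_labelAverage
      linearClassification_variance_le hε (Real.exp_pos (-(n / 16)))).trans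
      (ENNReal.ofReal_le_ofReal ?_)
    set t := Real.exp (-((n : ℝ) / 16)) with ht
    have ht0 : 0 < t := Real.exp_pos _
    have ht1 : t ≤ 1 := Real.exp_le_one_iff.2 (by linarith)
    have htw : t ≤ w := Real.exp_le_exp.2 (by nlinarith)
    have hnt : n * t ≤ 16 := by
      have h1 := Real.add_one_le_exp ((n : ℝ) / 16)
      have h2 : Real.exp ((n : ℝ) / 16) * t = 1 := by rw [ht, ← Real.exp_add]; simp
      nlinarith
    have hV : (2 ^ m : ℝ)⁻¹ / 4 ≤ t ^ 4 / 4 := by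
      gcongr
      rw [← inv_pow, ← one_div]
      refine (half_pow_le_exp m).trans ?_
      rw [ht, ← Real.exp_nat_mul]
      refine Real.exp_le_exp.2 ?_
      have : (n : ℝ) ≤ 2 * m := by exact_mod_cast h
      push_cast
      linarith
    have hnt3 : n * t ^ 4 ≤ 16 * t ^ 3 := by
      calc n * t ^ 4 = n * t * t ^ 3 := by ring
        _ ≤ _ := by gcongr
    have ht2 : t ^ 2 ≤ t := pow_le_of_le_one ht0.le ht1 two_ne_zero
    have ht3 : t ^ 3 ≤ t := pow_le_of_le_one ht0.le ht1 three_ne_zero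
    have hmarkov : 4 / ε ^ 2 ≤ 4 * n := by
      rw [div_le_iff₀ (by positivity)]
      linarith
    have hcost : n / t * (t ^ 4 / 4) ≤ 4 * t := by
      calc n / t * (t ^ 4 / 4) = n * t * t ^ 2 / 4 := by field_simp
        _ ≤ 16 * t ^ 2 / 4 := by gcongr
        _ ≤ 4 * t := by linarith
    have htail : Real.exp (-(n * ε ^ 2 / 2)) ≤ w := Real.exp_le_exp.2 (by linarith)
    calc q * (4 / ε ^ 2 * ((2 ^ m : ℝ)⁻¹ / 4) + t + (n / t + 2 * n) * ((2 ^ m : ℝ)⁻¹ / 4) +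
          2 * Real.exp (-(n * ε ^ 2 / 2)))
        ≤ q * (4 * n * (t ^ 4 / 4) + t + (n / t + 2 * n) * (t ^ 4 / 4) + 2 * w) := by gcongr
      -- The bracket is at most `(16 + 1 + 4 + 8) t + 2w`, and `t ≤ w`.
      _ ≤ q * (32 * w) := by
          refine mul_le_mul_of_nonneg_left ?_ (by positivity)
          rw [add_mul]
          linarith
      _ = 32 * q * w := by ring

end LinearBounds

end AdaptiveData

/-! ### The main theorem: choice of the constant. -/

open AdaptiveData in
theorem mainTheorem5 :
    ∃ C : ℝ, 0 < C ∧
      ∀ (m n q : ℕ) (ε δ : ℝ), 0 < ε → ε < 1 → 0 < δ → δ < 1 → 1 ≤ q →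
        C * (1 / ε ^ 2 * Real.log (q / δ)) ≤ n →
          ∀ (S : Type*) [MeasurableSpace S] (ρ : MeasureTheory.Measure S)
            [MeasureTheory.IsProbabilityMeasure ρ]
            (A : AdaptiveData.Analyst ((Fin m → ZMod 2) × ZMod 2) S),
            1 - δ ≤ (AdaptiveData.gameLaw (AdaptiveData.linearClassification m) ρ n q).real
              (AdaptiveData.allAccurate (AdaptiveData.linearClassification m) A n q ε) := by
  -- The binding demand is `C ≥ 9 exp 332`, where `332 = 4 · 81 + 8`, from the case `q = 1`, `nε² <
  -- 81`.
  refine ⟨Real.exp 400, Real.exp_pos _, ?_⟩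
  intro m n q ε δ hε hε1 hδ hδ1 hq hC S _ ρ _ A
  have := isProbabilityMeasure_gameLaw (linearClassification m) ρ (n := n) (q := q)
  have hq' : (1 : ℝ) ≤ q := by exact_mod_cast hq
  have hqδ : 1 < q / δ := by rw [lt_div_iff₀ hδ]; linarith
  have hlog : 0 < Real.log (q / δ) := Real.log_pos hqδ
  have hn' : (0 : ℝ) < n := lt_of_lt_of_le (by positivity) hC
  have hn : n ≠ 0 := by rintro rfl; simp at hn'
  have hnε : Real.exp 400 * Real.log (q / δ) ≤ n * ε ^ 2 := by
    have h1 := mul_le_mul_of_nonneg_right hC (sq_nonneg ε)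
    have h2 : Real.exp 400 * (1 / ε ^ 2 * Real.log (q / δ)) * ε ^ 2 =
        Real.exp 400 * Real.log (q / δ) := by field_simp
    linarith
  have hfail : ∀ {β : ℝ}, 0 ≤ β → β ≤ δ → gameLaw (linearClassification m) ρ n q
      (allAccurate (linearClassification m) A n q ε)ᶜ ≤ ENNReal.ofReal β →
      1 - δ ≤ (gameLaw (linearClassification m) ρ n q).real
        (allAccurate (linearClassification m) A n q ε) := by
    intro β hβ hβδ hle
    have h1 : (gameLaw (linearClassification m) ρ n q).real
        (allAccurate (linearClassification m) A n q ε)ᶜ ≤ β :=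
      ENNReal.toReal_le_of_le_ofReal hβ hle
    have h2 := measureReal_union_le (μ := gameLaw (linearClassification m) ρ n q)
      (allAccurate (linearClassification m) A n q ε)
      (allAccurate (linearClassification m) A n q ε)ᶜ
    rw [Set.union_compl_self, probReal_univ] at h2
    linarith
  have hA := gameLaw_compl_allAccurate_le ρ A hn hq hε hε1
  rcases le_or_gt 2 (q / δ) with h2 | h2
  · refine hfail (by positivity) ?_ hA
    -- Of the six powers one turns `q` into `δ`, and five cancel the factor `32 = 2⁵`; this needs `C
    -- ≥ 6 · 16`.
    have hexp : Real.exp (-(n * ε ^ 2 / 16)) ≤ (δ / q) ^ 6 := by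
      have h3 : δ / q = Real.exp (-Real.log (q / δ)) := by
        rw [Real.exp_neg, Real.exp_log (by positivity), inv_div]
      rw [h3, ← Real.exp_nat_mul]
      refine Real.exp_le_exp.2 ?_
      have h4 : (96 : ℝ) ≤ Real.exp 400 := by linarith [Real.add_one_le_exp (400 : ℝ)]
      have h5 := mul_le_mul_of_nonneg_right h4 hlog.le
      push_cast
      linarith
    have hr : δ / q ≤ 1 / 2 := by
      rw [div_le_div_iff₀ (by positivity) (by norm_num)]
      rw [le_div_iff₀ hδ] at h2
      linarith
    calc 32 * q * Real.exp (-(n * ε ^ 2 / 16)) ≤ 32 * q * (δ / q) ^ 6 := by gcongr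
      _ = 32 * (q * (δ / q)) * (δ / q) ^ 5 := by ring
      _ ≤ 32 * (q * (δ / q)) * (1 / 2) ^ 5 := by gcongr
      _ = δ := by field_simp; norm_num
  · rw [div_lt_iff₀ hδ] at h2
    have hq1 : q = 1 := by
      have : (q : ℝ) < 2 := by linarith
      have : q < 2 := by exact_mod_cast this
      omega
    subst hq1
    have hδ2 : 1 / 2 ≤ δ := by push_cast at h2; linarith
    -- `81 / 16 > 5` and `32 exp (-5) ≤ 1/2 ≤ δ`.
    rcases le_or_gt 81 (n * ε ^ 2) with h81 | h81
    · refine hfail (by positivity) (le_trans ?_ hδ2) hA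
      have h3 : (64 : ℝ) * Real.exp (-(n * ε ^ 2 / 16)) ≤ 1 := by
        have h4 : Real.exp (-(n * ε ^ 2 / 16)) ≤ Real.exp (-5) :=
          Real.exp_le_exp.2 (by linarith)
        have h5 : (64 : ℝ) ≤ Real.exp 5 := by
          calc (64 : ℝ) ≤ 2.7 ^ 5 := by norm_num
            _ ≤ Real.exp 1 ^ 5 := by
              gcongr
              linarith [Real.exp_one_gt_d9]
            _ = Real.exp 5 := by rw [← Real.exp_nat_mul]; norm_num
        have h6 : Real.exp 5 * Real.exp (-5) = 1 := by rw [← Real.exp_add]; simp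
        nlinarith [Real.exp_pos (-5)]
      push_cast
      linarith
    · have hB := le_gameLaw_allAccurate_one (linearClassification m) ρ A hn
        (linearClassification_sq_error_le hn) hε.le
      have hB' : ε * √n * Real.exp (-(4 * n * ε ^ 2 + 8)) ≤
          (gameLaw (linearClassification m) ρ n 1).real
            (allAccurate (linearClassification m) A n 1 ε) :=
        (ENNReal.ofReal_le_iff_le_toReal (measure_ne_top _ _)).1 hB
      refine le_trans ?_ hB'
      set u := ε * √n with hu
      have hu0 : 0 ≤ u := by positivity
      have husq : u ^ 2 = n * ε ^ 2 := by
        rw [hu, mul_pow, Real.sq_sqrt hn'.le, mul_comm]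
      have hu9 : u ≤ 9 := by nlinarith
      have hlogδ : 1 - δ ≤ Real.log ((1 : ℕ) / δ) := by
        rw [Nat.cast_one, one_div, Real.log_inv]
        linarith [Real.log_le_sub_one_of_pos hδ]
      have h3 : Real.exp (-332) ≤ Real.exp (-(4 * n * ε ^ 2 + 8)) :=
        Real.exp_le_exp.2 (by linarith)
      have h4 : 9 ≤ Real.exp 400 * Real.exp (-332) := by
        rw [← Real.exp_add]
        have := Real.add_one_le_exp (400 + -332 : ℝ)
        linarith
      -- The required success probability is quadratically small in `u`, as `1 - δ ≤ log (1/δ) ≤ u²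
      -- / C`, while the available one is linear in `u`; `u ≤ 9` closes the gap.
      have h5 : Real.exp 400 * (1 - δ) ≤ Real.exp 400 * (u * Real.exp (-332)) := by
        calc Real.exp 400 * (1 - δ) ≤ Real.exp 400 * Real.log ((1 : ℕ) / δ) := by gcongr
          _ ≤ u ^ 2 := by rw [husq]; exact hnε
          _ ≤ u * 9 := by rw [sq]; gcongr
          _ ≤ u * (Real.exp 400 * Real.exp (-332)) := by gcongr
          _ = _ := by ring
      calc 1 - δ ≤ u * Real.exp (-332) := le_of_mul_le_mul_left h5 (Real.exp_pos _)
        _ ≤ _ := by gcongr
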